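/- Let $a<b$ be real numbers. For $n\ge 1$ let $\mathcal M_n([a,b])=\{(m_1(\mu),\dots,m_n(\mu)) : \mu\in\mathcal P([a,b])\}\subset\mathbb R^n$, where $\mathcal P([a,b])$ is the set of Borel probability measures on $[a,b]$ and $m_i(\mu)=\int t^i\,d\mu(t)$. For $\vec m_n=(m_1,\dots,m_n)\in\mathbb R^n$ and $1\le k\le n$ let $m_k^-$ and $m_k^+$ be the minimum and the maximum of $m_k(\mu)$ over all $\mu\in\mathcal P([a,b])$ with $m_i(\mu)=m_i$ for $i=1,\dots,k-1$ (the condition $m_k^-<m_k<m_k^+$ below counts as violated if there is no such $\mu$), and, if $m_k^-<m_k<m_k^+$, let $$p_k(\vec m_n)=\frac{m_k-m_k^-}{m_k^+-m_k^-}$$ be the $k$-th canonical moment of $\vec m_n$. For every $k\ge 1$ let $f_k:(0,1)\to[0,\infty)$ be an integrable function such that $\int_{(1/2-\varepsilon,\,1/2+\varepsilon)\cap(0,1)} f_k(x)\,dx>0$ for all $\varepsilon>0$. For $n\ge1$ put $$f_n^{\mathcal M}(\vec m_n)=\prod_{k=1}^n c_{k,n}\,f_k(p_k(\vec m_n))\,\mathbf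 1\{m_k^-<m_k<m_k^+\},\qquad c_{k,n}=\Bigl((b-a)^{k}\int_0^1 f_k(x)(x-x^2)^{n-k}\,dx\Bigr)^{-1},$$ which is a probability density with respect to Lebesgue measure on $\mathbb R^n$, vanishing outside $\mathcal M_n([a,b])$. Let $\vec m_n$, $n\ge1$, be random vectors in $\mathcal M_n([a,b])$, defined on a common probability space (with arbitrary joint distribution), such that $\vec m_n$ has density $f_n^{\mathcal M}$ for every $n$. Denote by $p_k^{(n)}=p_k(\vec m_n)$, $1\le k\le n$, its canonical moments (which are almost surely defined). (a) Almost surely, for every $k\ge 1$, $p_k^{(n)}\to \tfrac12$ as $n\to\infty$. (b) If, for some $k\ge1$, the function $f_k$ is moreover continuous at $\tfrac12$ and $f_k(\tfrac12)>0$, then $\sqrt{8n}\,\bigl(p_k^{(n)}-\tfrac12\bigr)$ converges in distribution to $\mathcal N(0,1)$ as $n\to\infty$. -/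

import Mathlib

open MeasureTheory ProbabilityTheory Filter Set
open scoped ENNReal Topology

noncomputable section

namespace RandomMoments

/-- `μ` belongs to `𝒫([a,b])`: a Borel probability measure carried by `[a,b]`. -/
def IsProbOn (a b : ℝ) (μ : Measure ℝ) : Prop :=
  IsProbabilityMeasure μ ∧ μ (Icc a b)ᶜ = 0

/-- The moment of order `k`, `m_k(μ) = ∫ t^k dμ(t)`. -/
def powerMoment (μ : Measure ℝ) (k : ℕ) : ℝ := ∫ t, t ^ k ∂μ

/-- The `n`-th moment space `ℳ_n([a,b]) ⊆ ℝⁿ`. A vector `(m_1, …, m_n)` is written as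
`m : Fin n → ℝ`; the component with index `i : Fin n` is the moment of order `i + 1`. -/
def momentSpace (a b : ℝ) (n : ℕ) : Set (Fin n → ℝ) :=
  {m | ∃ μ : Measure ℝ, IsProbOn a b μ ∧ ∀ i : Fin n, powerMoment μ (i + 1) = m i}

/-- All possible values of the moment of order `k + 1` of a probability measure on `[a,b]` whose
moments of order `1, …, k` are the first `k` components of `m`. -/
def nextMoments (a b : ℝ) {n : ℕ} (m : Fin n → ℝ) (k : Fin n) : Set ℝ :=
  {x | ∃ μ : Measure ℝ, IsProbOn a b μ ∧ (∀ i : Fin n, i < k → powerMoment μ (i + 1) = m i) ∧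
    powerMoment μ (k + 1) = x}

/-- The lower bound `m⁻` for the component of `m` with index `k`. The set is compact, so that the
infimum is a minimum whenever the set is nonempty. -/
def lowerMoment (a b : ℝ) {n : ℕ} (m : Fin n → ℝ) (k : Fin n) : ℝ :=
  sInf (nextMoments a b m k)

/-- The upper bound `m⁺` for the component of `m` with index `k`. -/
def upperMoment (a b : ℝ) {n : ℕ} (m : Fin n → ℝ) (k : Fin n) : ℝ :=
  sSup (nextMoments a b m k)

/-- The canonical moment `(m - m⁻) / (m⁺ - m⁻)` of the component of `m` with index `k`, that is,
the canonical moment of order `k + 1`. -/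
def canonicalMoment (a b : ℝ) {n : ℕ} (m : Fin n → ℝ) (k : Fin n) : ℝ :=
  (m k - lowerMoment a b m k) / (upperMoment a b m k - lowerMoment a b m k)

/-- The canonical moment `p_k(m)` indexed by its order `k = 1, …, n`
(set to `0` for all other `k`, where it does not exist). -/
def canonicalMomentOfOrder (a b : ℝ) {n : ℕ} (m : Fin n → ℝ) (k : ℕ) : ℝ :=
  if h : 1 ≤ k ∧ k ≤ n then canonicalMoment a b m ⟨k - 1, by omega⟩ else 0

/-- The normalizing constant `c_{k,n} = ((b-a)^k ∫₀¹ f_k(x) (x-x²)^(n-k) dx)⁻¹`, `1 ≤ k ≤ n`. -/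
def normConst (a b : ℝ) (f : ℕ → ℝ → ℝ) (n k : ℕ) : ℝ :=
  ((b - a) ^ k * ∫ x in Ioo (0 : ℝ) 1, f k x * (x - x ^ 2) ^ (n - k))⁻¹

open Classical in
/-- The density `∏_{k=1}^n c_{k,n} f_k(p_k(m)) 1{m_k⁻ < m_k < m_k⁺}`. -/
def momentDensity (a b : ℝ) (f : ℕ → ℝ → ℝ) (n : ℕ) (m : Fin n → ℝ) : ℝ :=
  ∏ k : Fin n,
    if lowerMoment a b m k < m k ∧ m k < upperMoment a b m k then
      normConst a b f n (k + 1) * f (k + 1) (canonicalMoment a b m k)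
    else 0

/-- The distribution on `ℝⁿ` with density `momentDensity a b f n` with respect to Lebesgue
measure. -/
def momentLaw (a b : ℝ) (f : ℕ → ℝ → ℝ) (n : ℕ) : Measure (Fin n → ℝ) :=
  (volume : Measure (Fin n → ℝ)).withDensity fun m => ENNReal.ofReal (momentDensity a b f n m)

end RandomMoments

end

noncomputable section

namespace RandomMoments

/-! Everything rests on reading Lebesgue measure on the moment space in canonical moments. The map
from moments to canonical moments is triangular, and given the first `k - 1` moments it is affine in
`m_k` with slope `1 / (m_k⁺ - m_k⁻)`. The key identity is `m_k⁺ - m_k⁻ = (b-a)^k ∏_{j<k} p_j (1 -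
p_j)` (`momentWidth_eq`). Collecting powers of each `p_k`, Lebesgue measure becomes the product of
the measures `(b-a)^k (x - x²)^(n-k) dx` (`lintegral_prod_canonicalMoment`), so `p_k` has density
proportional to `f_k(x) (x - x²)^(n-k)` (`hasLaw_canonicalMoment`).

The width identity comes from orthogonal polynomials. For a weight `w` among `1`, `X - a`, `b - X`,
`(X - a)(b - X)` and the monic orthogonal polynomial `O` for `w`, the polynomial `w O²` is
nonnegative on `[a,b]` with leading coefficient `±1`, so its integral bounds the next moment on one
side. Gauss quadrature on the zeros of `w O` attains the bound (`exists_orthogonal_extremal`). Hence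
the distances from a moment to its two bounds are squared norms of orthogonal polynomials. Pairing
polynomials of consecutive levels relates four such norms, which gives the recursion
`momentWidth_snoc`.

The factor `x - x²` is maximal only at `1/2`. Mass away from `1/2` therefore decays geometrically in
`n`, and the first Borel–Cantelli lemma gives (a) for any joint distribution. For (b), `4 (x - x²) =
1 - 4 (x - 1/2)²`, and `x = 1/2 + y / √(8n)` turns the weight into `(1 - y²/(2n))^(n-k) →
exp(-y²/2)`; Laplace's method concludes. -/

open Polynomial in
/-- `L` is strictly positive on the nonzero polynomials of degree less than `k` that are
nonnegative on `[a,b]`. -/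
def PosBelow (a b : ℝ) (L : ℝ[X] →ₗ[ℝ] ℝ) (k : ℕ) : Prop :=
  ∀ p : ℝ[X], p ≠ 0 → p.natDegree < k → (∀ t ∈ Icc a b, 0 ≤ p.eval t) → 0 < L p

open Polynomial in
/-- The polynomial `b - X` if `u = b`, and `X - u` otherwise. -/
def edgeFactor (b u : ℝ) : ℝ[X] := if u = b then C b - X else X - C u

open Polynomial in
/-- The weight `∏_{u ∈ T} |X - u|` for a set `T` of endpoints of `[a,b]`. -/
def edgeWeight (b : ℝ) (T : Finset ℝ) : ℝ[X] := ∏ u ∈ T, edgeFactor b u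

/-- The leading coefficient of `edgeWeight b T`. -/
def edgeSign (b : ℝ) (T : Finset ℝ) : ℝ := ∏ u ∈ T, if u = b then -1 else 1

/-! ### Orthogonal polynomials and Gauss quadrature -/

section Orthogonal

open Polynomial

variable {a b : ℝ} {L : ℝ[X] →ₗ[ℝ] ℝ}

lemma PosBelow.mono {k l : ℕ} (h : PosBelow a b L k) (hl : l ≤ k) : PosBelow a b L l :=
  fun p hp hd => h p hp (hd.trans_le hl)

lemma edgeSign_ne_zero (T : Finset ℝ) : edgeSign b T ≠ 0 := by
  rw [edgeSign, Finset.prod_ne_zero_iff]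
  intro u _
  split_ifs <;> norm_num

lemma edgeFactor_eq (u : ℝ) : edgeFactor b u = C (if u = b then -1 else 1) * (X - C u) := by
  unfold edgeFactor
  split_ifs with h
  · subst h; simp
  · simp

lemma edgeWeight_eq (T : Finset ℝ) :
    edgeWeight b T = C (edgeSign b T) * Lagrange.nodal T id := by
  simp only [edgeWeight, edgeFactor_eq, Finset.prod_mul_distrib, edgeSign, Lagrange.nodal_eq,
    map_prod, id]

lemma edgeWeight_ne_zero (T : Finset ℝ) : edgeWeight b T ≠ 0 := by
  rw [edgeWeight_eq]
  exact mul_ne_zero (by simpa using edgeSign_ne_zero T) Lagrange.nodal_ne_zero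

lemma natDegree_edgeWeight (T : Finset ℝ) : (edgeWeight b T).natDegree = T.card := by
  rw [edgeWeight_eq, natDegree_C_mul (edgeSign_ne_zero T), Lagrange.natDegree_nodal]

lemma leadingCoeff_edgeWeight (T : Finset ℝ) : (edgeWeight b T).leadingCoeff = edgeSign b T := by
  rw [edgeWeight_eq, leadingCoeff_mul, leadingCoeff_C, Lagrange.nodal_monic.leadingCoeff, mul_one]

lemma eval_edgeFactor_nonneg {u t : ℝ} (hu : u = a ∨ u = b) (ht : t ∈ Icc a b) :
    0 ≤ (edgeFactor b u).eval t := by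
  unfold edgeFactor
  split_ifs with h
  · simpa using ht.2
  · rcases hu with rfl | rfl
    · simpa using ht.1
    · exact absurd rfl h

lemma eval_edgeWeight_nonneg {T : Finset ℝ} (hT : T ⊆ {a, b}) {t : ℝ} (ht : t ∈ Icc a b) :
    0 ≤ (edgeWeight b T).eval t := by
  rw [edgeWeight, eval_prod]
  exact Finset.prod_nonneg fun u hu =>
    eval_edgeFactor_nonneg (by simpa using hT hu) ht

lemma eval_edgeWeight_eq_zero {T : Finset ℝ} {t : ℝ} (ht : t ∈ T) :
    (edgeWeight b T).eval t = 0 := by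
  rw [edgeWeight_eq, eval_mul, Lagrange.eval_nodal, Finset.prod_eq_zero ht (by simp), mul_zero]

/-- Makes `(r, s) ↦ L (w r s)` positive definite on polynomials of low degree. -/
lemma PosBelow.weight_sq_pos {T : Finset ℝ} (hT : T ⊆ {a, b}) {k : ℕ} (hL : PosBelow a b L k)
    {r : ℝ[X]} (hr : r ≠ 0) (hd : T.card + 2 * r.natDegree < k) :
    0 < L (edgeWeight b T * (r * r)) := by
  refine hL _ (mul_ne_zero (edgeWeight_ne_zero T) (mul_ne_zero hr hr)) ?_ fun t ht => ?_
  · rw [natDegree_mul (edgeWeight_ne_zero T) (mul_ne_zero hr hr), natDegree_mul hr hr,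
      natDegree_edgeWeight]
    omega
  · rw [eval_mul, eval_mul]
    exact mul_nonneg (eval_edgeWeight_nonneg hT ht) (mul_self_nonneg _)

/-- Existence of monic orthogonal polynomials. -/
lemma PosBelow.exists_orthogonal {T : Finset ℝ} (hT : T ⊆ {a, b}) {d : ℕ}
    (hL : PosBelow a b L (T.card + 2 * d)) :
    ∃ O : ℝ[X], O.Monic ∧ O.natDegree = d ∧
      ∀ r : ℝ[X], r.degree < d → L (edgeWeight b T * (O * r)) = 0 := by
  let Φ : degreeLT ℝ d →ₗ[ℝ] Module.Dual ℝ (degreeLT ℝ d) :=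
    LinearMap.mk₂ ℝ (fun r s => L (edgeWeight b T * ((r : ℝ[X]) * (s : ℝ[X]))))
      (fun r r' s => by simp [add_mul, mul_add]) (fun c r s => by simp)
      (fun r s s' => by simp [mul_add]) (fun c r s => by simp)
  have hΦ : ∀ r s : degreeLT ℝ d, Φ r s = L (edgeWeight b T * ((r : ℝ[X]) * (s : ℝ[X]))) :=
    fun r s => rfl
  have hinj : Function.Injective Φ := by
    rw [← LinearMap.ker_eq_bot, LinearMap.ker_eq_bot']
    intro r hr
    by_contra hne
    have hne' : (r : ℝ[X]) ≠ 0 := by simpa using hne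
    have hdeg : (r : ℝ[X]).natDegree < d :=
      (natDegree_lt_iff_degree_lt hne').2 (mem_degreeLT.1 r.2)
    have := hL.weight_sq_pos hT hne' (by omega)
    rw [← hΦ, hr] at this
    simp at this
  have hsurj : Function.Surjective Φ :=
    (LinearMap.injective_iff_surjective_of_finrank_eq_finrank
      Subspace.dual_finrank_eq.symm).1 hinj
  -- The nondegenerate form represents pairing with `X ^ d` by some `r` of degree less than `d`;
  -- then `X ^ d - r` is orthogonal to all lower degrees.
  let φ : Module.Dual ℝ (degreeLT ℝ d) :=
    { toFun := fun s => L (edgeWeight b T * (X ^ d * (s : ℝ[X])))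
      map_add' := fun s s' => by simp [mul_add]
      map_smul' := fun c s => by simp }
  obtain ⟨r, hr⟩ := hsurj φ
  have hrd : (r : ℝ[X]).degree < d := mem_degreeLT.1 r.2
  refine ⟨X ^ d - (r : ℝ[X]), monic_X_pow_sub hrd, ?_, fun s hs => ?_⟩
  · exact natDegree_eq_of_degree_eq_some (by
      rw [degree_sub_eq_left_of_degree_lt (by rwa [degree_X_pow]), degree_X_pow])
  · have := congrArg (fun ψ => ψ ⟨s, mem_degreeLT.2 hs⟩) hr
    have h2 : L (edgeWeight b T * ((r : ℝ[X]) * s)) = L (edgeWeight b T * (X ^ d * s)) := this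
    rw [sub_mul, mul_sub, map_sub, h2, sub_self]

/-- Either a polynomial can be made nonnegative on `[a,b]` by a factor of smaller degree, or it
has only simple roots, all of them in `(a,b)`. -/
lemma exists_sign_factor_or_simple_roots (hab : a < b) (O : ℝ[X]) (hO : O ≠ 0) :
    (∃ r : ℝ[X], r ≠ 0 ∧ r.natDegree ≤ O.natDegree ∧ (∀ t ∈ Icc a b, 0 ≤ (O * r).eval t) ∧
      (r.natDegree < O.natDegree ∨
        ∃ s : Finset ℝ, (∀ t ∈ s, t ∈ Ioo a b) ∧ O = C O.leadingCoeff * Lagrange.nodal s id)) := by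
  induction hn : O.natDegree generalizing O with
  | zero =>
    rw [natDegree_eq_zero] at hn
    obtain ⟨c, rfl⟩ := hn
    refine ⟨C c, hO, by simp, fun t _ => by simpa using mul_self_nonneg c,
      Or.inr ⟨∅, by simp, by simp⟩⟩
  | succ n ih =>
    by_cases hroot : ∃ t ∈ Ioo a b, O.eval t = 0
    · obtain ⟨t, ht, h0⟩ := hroot
      obtain ⟨O', rfl⟩ := dvd_iff_isRoot.2 h0
      have hO' : O' ≠ 0 := right_ne_zero_of_mul hO
      have hdeg : O'.natDegree = n := by
        rw [natDegree_mul (X_sub_C_ne_zero t) hO', natDegree_X_sub_C] at hn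
        omega
      obtain ⟨r, hr0, hrd, hr, hcase⟩ := ih O' hO' hdeg
      have hgood : ∀ x ∈ Icc a b, 0 ≤ ((X - C t) * O' * ((X - C t) * r)).eval x := by
        intro x hx
        have := hr x hx
        simp only [eval_mul, eval_sub, eval_X, eval_C] at this ⊢
        nlinarith [mul_nonneg (mul_self_nonneg (x - t)) this]
      have hdr : ((X - C t) * r).natDegree = r.natDegree + 1 := by
        rw [natDegree_mul (X_sub_C_ne_zero t) hr0, natDegree_X_sub_C, add_comm]
      rcases hcase with hlt | ⟨s, hs, hOs⟩
      · exact ⟨(X - C t) * r, mul_ne_zero (X_sub_C_ne_zero t) hr0, by omega, hgood,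
          Or.inl (by omega)⟩
      -- If `t` is already a root of `O'`, it is a double root of the product, and omitting both
      -- factors `X - t` from the multiplier still leaves a perfect square.
      · by_cases hts : t ∈ s
        · rw [Lagrange.nodal_eq_mul_nodal_erase hts] at hOs
          set N := Lagrange.nodal (s.erase t) id with hN
          set c := O'.leadingCoeff
          have hc : c ≠ 0 := leadingCoeff_ne_zero.2 hO'
          have hNd : n = N.natDegree + 1 := by
            rw [← hdeg, hOs, natDegree_C_mul hc,
              natDegree_mul (X_sub_C_ne_zero _) Lagrange.nodal_ne_zero, natDegree_X_sub_C, add_comm]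
          refine ⟨C c * N, mul_ne_zero (by simpa using hc) Lagrange.nodal_ne_zero, ?_, ?_,
            Or.inl ?_⟩
          · rw [natDegree_C_mul hc]; omega
          · intro x _
            rw [hOs]
            simp only [eval_mul, eval_sub, eval_X, eval_C, id]
            have : (x - t) * (c * ((x - t) * N.eval x)) * (c * N.eval x)
              = ((x - t) * c * N.eval x) ^ 2 := by ring
            rw [this]
            positivity
          · rw [natDegree_C_mul hc]; omega
        · refine ⟨(X - C t) * r, mul_ne_zero (X_sub_C_ne_zero t) hr0, by omega, hgood,
            Or.inr ⟨insert t s, ?_, ?_⟩⟩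
          · intro x hx
            rcases Finset.mem_insert.1 hx with rfl | hx
            · exact ht
            · exact hs x hx
          · rw [Lagrange.nodal_insert_eq_nodal hts]
            conv_lhs => rw [hOs]
            rw [leadingCoeff_mul, leadingCoeff_X_sub_C, one_mul, id]
            ring
    -- Without a root in `(a,b)` the sign is constant there, so the value at the midpoint serves as
    -- a constant multiplier; the inequality extends to the endpoints by closure.
    · push Not at hroot
      have hm : (a + b) / 2 ∈ Ioo a b := ⟨by linarith, by linarith⟩
      have hclos : ∀ t ∈ Ioo a b, 0 ≤ O.eval t * O.eval ((a + b) / 2) := by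
        intro t ht
        by_contra hneg
        push Not at hneg
        have hivt := isPreconnected_Ioo (a := a) (b := b)
        have hc : ContinuousOn (fun x => O.eval x) (Ioo a b) := O.continuous.continuousOn
        rcases mul_neg_iff.1 hneg with ⟨h1, h2⟩ | ⟨h1, h2⟩
        · obtain ⟨x, hx, hx0⟩ := hivt.intermediate_value hm ht hc ⟨h2.le, h1.le⟩
          exact hroot x hx hx0
        · obtain ⟨x, hx, hx0⟩ := hivt.intermediate_value ht hm hc ⟨h1.le, h2.le⟩
          exact hroot x hx hx0
      refine ⟨C (O.eval ((a + b) / 2)), by simpa using hroot _ hm, by simp, ?_,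
        Or.inl (by simp)⟩
      have hcl : IsClosed {t | 0 ≤ (O * C (O.eval ((a + b) / 2))).eval t} :=
        isClosed_le continuous_const (Polynomial.continuous _)
      have := hcl.closure_subset_iff.2 (fun t ht => by simpa using hclos t ht : Ioo a b ⊆ _)
      rwa [closure_Ioo hab.ne] at this

/-- A sign-correcting factor `r` of degree less than `d` would give `L (w O r) = 0` by
orthogonality, although `w O r` is nonzero, nonnegative on `[a,b]` and of degree below `|T| + 2d`.
-/
lemma PosBelow.orthogonal_simple_roots (hab : a < b) {T : Finset ℝ} (hT : T ⊆ {a, b}) {d : ℕ}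
    (hL : PosBelow a b L (T.card + 2 * d)) {O : ℝ[X]} (hO : O.Monic) (hd : O.natDegree = d)
    (horth : ∀ r : ℝ[X], r.degree < d → L (edgeWeight b T * (O * r)) = 0) :
    ∃ s : Finset ℝ, (∀ t ∈ s, t ∈ Ioo a b) ∧ O = Lagrange.nodal s id := by
  obtain ⟨r, hr0, -, hr, hlt | ⟨s, hs, hOs⟩⟩ :=
    exists_sign_factor_or_simple_roots hab O hO.ne_zero
  · have h0 := horth r (by rw [← hd]; exact degree_lt_degree hlt |>.trans_le degree_le_natDegree)
    have hpos := hL (edgeWeight b T * (O * r))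
      (mul_ne_zero (edgeWeight_ne_zero T) (mul_ne_zero hO.ne_zero hr0)) (by
        rw [natDegree_mul (edgeWeight_ne_zero T) (mul_ne_zero hO.ne_zero hr0),
          natDegree_mul hO.ne_zero hr0, natDegree_edgeWeight]
        omega) (fun t ht => by
          rw [eval_mul]
          exact mul_nonneg (eval_edgeWeight_nonneg hT ht) (hr t ht))
    exact absurd h0 hpos.ne'
  · exact ⟨s, hs, by rwa [hO.leadingCoeff, C_1, one_mul] at hOs⟩

/-- Gauss quadrature: a functional that is strictly positive below degree `|T| + 2d` is represented
there by a probability measure carried by the zeros of its orthogonal polynomial and by `T`. -/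
lemma PosBelow.exists_quadrature (hab : a < b) {T : Finset ℝ} (hT : T ⊆ {a, b}) {d : ℕ}
    (hk : 0 < T.card + 2 * d)
    (hL : PosBelow a b L (T.card + 2 * d)) (hL1 : L 1 = 1) {O : ℝ[X]} (hO : O.Monic)
    (hd : O.natDegree = d)
    (horth : ∀ r : ℝ[X], r.degree < d → L (edgeWeight b T * (O * r)) = 0) :
    ∃ ν : Measure ℝ, IsProbOn a b ν ∧
      (∀ p : ℝ[X], p.natDegree < T.card + 2 * d → ∫ t, p.eval t ∂ν = L p) ∧
      ∫ t, (edgeWeight b T * (O * O)).eval t ∂ν = 0 := by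
  classical
  obtain ⟨s, hs, hOs⟩ := hL.orthogonal_simple_roots hab hT hO hd horth
  have hscard : s.card = d := by rw [← hd, hOs, Lagrange.natDegree_nodal]
  have hdisj : Disjoint T s := by
    rw [Finset.disjoint_left]
    intro t htT hts
    have h1 := hs t hts
    rcases Finset.mem_insert.1 (hT htT) with rfl | h
    · exact lt_irrefl _ h1.1
    · rw [Finset.mem_singleton.1 h] at h1
      exact lt_irrefl _ h1.2
  set S := T ∪ s with hS
  have hScard : S.card = T.card + d := by rw [hS, Finset.card_union_of_disjoint hdisj, hscard]
  have hSIcc : ∀ t ∈ S, t ∈ Icc a b := by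
    intro t ht
    rcases Finset.mem_union.1 ht with h | h
    · rcases Finset.mem_insert.1 (hT h) with rfl | h
      · exact ⟨le_rfl, hab.le⟩
      · rw [Finset.mem_singleton.1 h]
        exact ⟨hab.le, le_rfl⟩
    · exact ⟨(hs t h).1.le, (hs t h).2.le⟩
  have hnodal : Lagrange.nodal S id * C (edgeSign b T) = edgeWeight b T * O := by
    rw [edgeWeight_eq, hOs, Lagrange.nodal_eq, Lagrange.nodal_eq, Lagrange.nodal_eq, hS,
      Finset.prod_union hdisj]
    ring
  have hsmall : ∀ p : ℝ[X], p.degree < S.card →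
      L p = ∑ t ∈ S, p.eval t * L (Lagrange.basis S id t) := by
    intro p hp
    conv_lhs => rw [Lagrange.eq_interpolate (s := S) (v := id) (Function.injective_id.injOn) hp]
    rw [Lagrange.interpolate_apply, map_sum]
    refine Finset.sum_congr rfl fun t _ => ?_
    rw [← smul_eq_C_mul, map_smul, smul_eq_mul, id]
  have hN0 : ∀ t ∈ S, (Lagrange.nodal S id).eval t = 0 := fun t ht => by
    simpa using Lagrange.eval_nodal_at_node (v := id) ht
  -- Divide by the nodal polynomial, which is `± w O`: the quotient has degree less than `d` and is
  -- killed by orthogonality, while the remainder is interpolated exactly.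
  have hquad : ∀ p : ℝ[X], p.natDegree < T.card + 2 * d →
      L p = ∑ t ∈ S, p.eval t * L (Lagrange.basis S id t) := by
    intro p hp
    have hNm : (Lagrange.nodal S id : ℝ[X]).Monic := Lagrange.nodal_monic
    have hdiv := modByMonic_add_div p (Lagrange.nodal S (id : ℝ → ℝ))
    have hq : (p /ₘ Lagrange.nodal S id).degree < d := by
      by_cases hz : p /ₘ Lagrange.nodal S id = 0
      · rw [hz, degree_zero]
        exact WithBot.bot_lt_coe d
      · rw [← natDegree_lt_iff_degree_lt hz, natDegree_divByMonic p hNm, Lagrange.natDegree_nodal]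
        have : d ≠ 0 := by
          rintro rfl
          apply hz
          rw [divByMonic_eq_zero_iff hNm, Lagrange.degree_nodal]
          refine (degree_le_natDegree).trans_lt ?_
          exact_mod_cast (by omega : p.natDegree < S.card)
        omega
    have hzero : L (Lagrange.nodal S id * (p /ₘ Lagrange.nodal S id)) = 0 := by
      have h := horth _ hq
      rw [← mul_assoc, ← hnodal, mul_right_comm, mul_comm, ← smul_eq_C_mul, map_smul,
        smul_eq_mul] at h
      exact (mul_eq_zero.1 h).resolve_left (edgeSign_ne_zero T)
    have hmod : (p %ₘ Lagrange.nodal S id).degree < S.card := by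
      have := degree_modByMonic_lt p hNm
      rwa [Lagrange.degree_nodal] at this
    conv_lhs => rw [← hdiv, map_add, hzero, add_zero, hsmall _ hmod]
    refine Finset.sum_congr rfl fun t ht => ?_
    conv_rhs => rw [← hdiv, eval_add, eval_mul, hN0 t ht, zero_mul, add_zero]
  have hweight : ∀ t ∈ S, 0 ≤ L (Lagrange.basis S id t) := by
    intro t ht
    -- The weight at `t` is read off from a nonnegative `q` of admissible degree vanishing at all
    -- other nodes. Dropping the factor of `t` from `w O²` gives `q` for an endpoint; dropping its
    -- square does so for an interior node.
    have key : ∀ q : ℝ[X], q ≠ 0 → q.natDegree < T.card + 2 * d →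
        (∀ x ∈ Icc a b, 0 ≤ q.eval x) → (∀ x ∈ S, x ≠ t → q.eval x = 0) →
        0 ≤ L (Lagrange.basis S id t) := by
      intro q hq hdeg hnn hz
      have h1 := hL q hq hdeg hnn
      rw [hquad q hdeg, Finset.sum_eq_single t (fun x hx hxt => by rw [hz x hx hxt, zero_mul])
        (fun h => absurd ht h)] at h1
      exact (pos_of_mul_pos_right h1 (hnn t (hSIcc t ht))).le
    have hO0 : ∀ x ∈ s, O.eval x = 0 := fun x hx => by
      rw [hOs]; simpa using Lagrange.eval_nodal_at_node (v := id) hx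
    rcases Finset.mem_union.1 ht with hT' | hs'
    · refine key (edgeWeight b (T.erase t) * (O * O))
        (mul_ne_zero (edgeWeight_ne_zero _) (mul_ne_zero hO.ne_zero hO.ne_zero)) ?_ ?_ ?_
      · rw [natDegree_mul (edgeWeight_ne_zero _) (mul_ne_zero hO.ne_zero hO.ne_zero),
          natDegree_mul hO.ne_zero hO.ne_zero, natDegree_edgeWeight, hd,
          Finset.card_erase_of_mem hT']
        have := Finset.card_pos.2 ⟨t, hT'⟩
        omega
      · intro x hx
        rw [eval_mul, eval_mul]
        exact mul_nonneg (eval_edgeWeight_nonneg ((Finset.erase_subset _ _).trans hT) hx)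
          (mul_self_nonneg _)
      · intro x hx hxt
        rw [eval_mul, eval_mul]
        rcases Finset.mem_union.1 hx with h | h
        · rw [eval_edgeWeight_eq_zero (Finset.mem_erase.2 ⟨hxt, h⟩), zero_mul]
        · rw [hO0 x h]; ring
    · have hr0 : (Lagrange.nodal (s.erase t) id : ℝ[X]) ≠ 0 := Lagrange.nodal_ne_zero
      refine key (edgeWeight b T * (Lagrange.nodal (s.erase t) id * Lagrange.nodal (s.erase t) id))
        (mul_ne_zero (edgeWeight_ne_zero _) (mul_ne_zero hr0 hr0)) ?_ ?_ ?_
      · rw [natDegree_mul (edgeWeight_ne_zero _) (mul_ne_zero hr0 hr0),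
          natDegree_mul hr0 hr0, natDegree_edgeWeight, Lagrange.natDegree_nodal,
          Finset.card_erase_of_mem hs']
        have := Finset.card_pos.2 ⟨t, hs'⟩
        omega
      · intro x hx
        rw [eval_mul, eval_mul]
        exact mul_nonneg (eval_edgeWeight_nonneg hT hx) (mul_self_nonneg _)
      · intro x hx hxt
        rw [eval_mul, eval_mul]
        rcases Finset.mem_union.1 hx with h | h
        · rw [eval_edgeWeight_eq_zero h, zero_mul]
        · have : (Lagrange.nodal (s.erase t) id : ℝ[X]).eval x = 0 := by
            simpa using Lagrange.eval_nodal_at_node (v := id) (Finset.mem_erase.2 ⟨hxt, h⟩)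
          rw [this]; ring
  let ν : Measure ℝ :=
    ∑ t ∈ S, ENNReal.ofReal (L (Lagrange.basis S id t)) • Measure.dirac t
  have hint : ∀ g : ℝ → ℝ, ∫ x, g x ∂ν = ∑ t ∈ S, g t * L (Lagrange.basis S id t) := by
    intro g
    rw [integral_finsetSum_measure fun t _ => (integrable_dirac (by simp)).smul_measure (by simp)]
    refine Finset.sum_congr rfl fun t ht => ?_
    rw [integral_smul_measure, integral_dirac, ENNReal.toReal_ofReal (hweight t ht), smul_eq_mul,
      mul_comm]
  refine ⟨ν, ⟨⟨?_⟩, ?_⟩, fun p hp => by rw [hint, hquad p hp], ?_⟩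
  · have h1 := hquad 1 (by simpa using hk)
    simp only [ν, Measure.coe_finsetSum, Finset.sum_apply, Measure.smul_apply, measure_univ,
      smul_eq_mul, mul_one]
    rw [← ENNReal.ofReal_sum_of_nonneg hweight]
    simp only [hL1, eval_one, one_mul] at h1
    rw [← h1, ENNReal.ofReal_one]
  · simp only [ν, Measure.coe_finsetSum, Finset.sum_apply, Measure.smul_apply, smul_eq_mul]
    refine Finset.sum_eq_zero fun t ht => ?_
    rw [Measure.dirac_apply' _ measurableSet_Icc.compl, indicator_of_notMem (by
      simpa using hSIcc t ht), mul_zero]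
  -- `w O²` has degree `|T| + 2d`, just outside the range of exactness, but it vanishes at every
  -- node.
  · rw [hint]
    refine Finset.sum_eq_zero fun t ht => ?_
    rw [← mul_assoc, ← hnodal, eval_mul, eval_mul, hN0 t ht]
    ring

end Orthogonal

/-! ### Norm identities between orthogonal polynomials for the four weights -/

section Recursion

open Polynomial

variable {a b : ℝ} {L : ℝ[X] →ₗ[ℝ] ℝ}

/-- `O` is the monic polynomial of degree `d` that is orthogonal, with respect to `L` with weight
`w`, to all polynomials of smaller degree. -/
structure IsOrthogonal (L : ℝ[X] →ₗ[ℝ] ℝ) (w : ℝ[X]) (d : ℕ) (O : ℝ[X]) : Prop where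
  monic : O.Monic
  natDegree_eq : O.natDegree = d
  orthogonal : ∀ r : ℝ[X], r.degree < d → L (w * (O * r)) = 0

/-- Subtracting `p.coeff d` times the monic `O` leaves degree less than `d`, which is orthogonal to
`O`. -/
lemma IsOrthogonal.apply_mul {w O : ℝ[X]} {d : ℕ} (h : IsOrthogonal L w d O) {p : ℝ[X]}
    (hp : p.natDegree ≤ d) : L (w * (O * p)) = p.coeff d * L (w * (O * O)) := by
  have hcoeff : O.coeff d = 1 := by
    have := h.monic
    rwa [Monic, leadingCoeff, h.natDegree_eq] at this
  have hdeg : (p - C (p.coeff d) * O).degree < d := by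
    rw [degree_lt_iff_coeff_zero]
    intro m hm
    rcases hm.eq_or_lt with rfl | hlt
    · simp [hcoeff]
    · rw [coeff_sub, coeff_C_mul, coeff_eq_zero_of_natDegree_lt (hp.trans_lt hlt),
        coeff_eq_zero_of_natDegree_lt (h.natDegree_eq.trans_lt hlt)]
      simp
  have h0 := h.orthogonal _ hdeg
  have : w * (O * (p - C (p.coeff d) * O)) = w * (O * p) - C (p.coeff d) * (w * (O * O)) := by
    ring
  rw [this, map_sub, ← smul_eq_C_mul, map_smul, smul_eq_mul] at h0
  linarith

lemma IsOrthogonal.coeff_self {w O : ℝ[X]} {d : ℕ} (h : IsOrthogonal L w d O) :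
    O.coeff d = 1 := by
  have := h.monic
  rwa [Monic, leadingCoeff, h.natDegree_eq] at this

lemma IsOrthogonal.natDegree_le {w O : ℝ[X]} {d : ℕ} (h : IsOrthogonal L w d O) :
    O.natDegree ≤ d := h.natDegree_eq.le

lemma coeff_X_sub_C_mul' (p : ℝ[X]) (c : ℝ) (k : ℕ) :
    ((X - C c) * p).coeff k = (X * p).coeff k - c * p.coeff k := by
  rw [sub_mul, coeff_sub, coeff_C_mul]

lemma coeff_C_sub_X_mul (p : ℝ[X]) (c : ℝ) (k : ℕ) :
    ((C c - X) * p).coeff k = c * p.coeff k - (X * p).coeff k := by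
  rw [sub_mul, coeff_sub, coeff_C_mul]

lemma natDegree_X_sub_C_mul_le {p : ℝ[X]} {d : ℕ} (hp : p.natDegree ≤ d) (c : ℝ) :
    ((X - C c) * p).natDegree ≤ d + 1 := by
  have := natDegree_mul_le (p := X - C c) (q := p)
  rw [natDegree_X_sub_C] at this
  omega

lemma natDegree_C_sub_X_mul_le {p : ℝ[X]} {d : ℕ} (hp : p.natDegree ≤ d) (c : ℝ) :
    ((C c - X) * p).natDegree ≤ d + 1 := by
  rw [← neg_sub, neg_mul, natDegree_neg]
  exact natDegree_X_sub_C_mul_le hp c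

lemma natDegree_le_of_coeff_succ {p : ℝ[X]} {d : ℕ} (hp : p.natDegree ≤ d + 1)
    (h0 : p.coeff (d + 1) = 0) : p.natDegree ≤ d := by
  simpa using natDegree_le_pred hp h0

/-- The relation between the squared norms of the four families of orthogonal polynomials when the
lower level is even. -/
lemma orthogonal_recursion_even {i : ℕ} {P Q R S : ℝ[X]}
    (hP : IsOrthogonal L 1 (i + 1) P) (hQ : IsOrthogonal L (X - C a) (i + 1) Q)
    (hR : IsOrthogonal L (C b - X) (i + 1) R) (hS : IsOrthogonal L ((X - C a) * (C b - X)) i S) :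
    let A := L (1 * (P * P))
    let B := L ((X - C a) * (Q * Q))
    let C' := L ((C b - X) * (R * R))
    let D := L ((X - C a) * (C b - X) * (S * S))
    (B + C') * (A + D) = (b - a) * (D * A) := by
  intro A B C' D
  -- The leading terms cancel in both combinations. Pairing the first with `P` and `R - Q` with `S`,
  -- each evaluated in two ways, gives `B + C' = α A` and `B + C' = β D`. The unknown subleading
  -- coefficients drop out of `α + β = b - a`.
  have hF : ((X - C a) * Q + (C b - X) * R).natDegree ≤ i + 1 := by
    refine natDegree_le_of_coeff_succ ((natDegree_add_le _ _).trans (max_le ?_ ?_)) ?_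
    · exact natDegree_X_sub_C_mul_le hQ.natDegree_le a
    · exact natDegree_C_sub_X_mul_le hR.natDegree_le b
    · rw [coeff_add, coeff_X_sub_C_mul', coeff_C_sub_X_mul, coeff_X_mul,
        coeff_X_mul, hQ.coeff_self, hR.coeff_self,
        coeff_eq_zero_of_natDegree_lt (hQ.natDegree_le.trans_lt (Nat.lt_succ_self _)),
        coeff_eq_zero_of_natDegree_lt (hR.natDegree_le.trans_lt (Nat.lt_succ_self _))]
      ring
  have hG : (R - Q).natDegree ≤ i := by
    refine natDegree_le_of_coeff_succ ((natDegree_sub_le _ _).trans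
      (max_le hR.natDegree_le hQ.natDegree_le)) ?_
    rw [coeff_sub, hR.coeff_self, hQ.coeff_self, sub_self]
  have h1 := hP.apply_mul hF
  have h2 := hS.apply_mul hG
  have e1 : 1 * (P * ((X - C a) * Q + (C b - X) * R))
      = (X - C a) * (Q * P) + (C b - X) * (R * P) := by ring
  have e2 : (X - C a) * (C b - X) * (S * (R - Q))
      = (C b - X) * (R * ((X - C a) * S)) - (X - C a) * (Q * ((C b - X) * S)) := by ring
  rw [e1, map_add, hQ.apply_mul hP.natDegree_le, hR.apply_mul hP.natDegree_le, hP.coeff_self,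
    coeff_add, coeff_X_sub_C_mul', coeff_C_sub_X_mul, coeff_X_mul,
    coeff_X_mul, hQ.coeff_self, hR.coeff_self] at h1
  rw [e2, map_sub, hR.apply_mul (natDegree_X_sub_C_mul_le hS.natDegree_le a),
    hQ.apply_mul (natDegree_C_sub_X_mul_le hS.natDegree_le b), coeff_X_sub_C_mul',
    coeff_C_sub_X_mul, coeff_X_mul, hS.coeff_self,
    coeff_eq_zero_of_natDegree_lt (hS.natDegree_le.trans_lt (Nat.lt_succ_self _)), coeff_sub] at h2
  change 1 * B + 1 * C' = _ * A at h1
  change (1 - a * 0) * C' - (b * 0 - 1) * B = _ * D at h2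
  linear_combination (D : ℝ) * h1 + A * h2

/-- The relation between the squared norms of the four families of orthogonal polynomials when the
lower level is odd. -/
lemma orthogonal_recursion_odd {i : ℕ} {P Q R S : ℝ[X]}
    (hP : IsOrthogonal L 1 (i + 1) P) (hQ : IsOrthogonal L (X - C a) i Q)
    (hR : IsOrthogonal L (C b - X) i R) (hS : IsOrthogonal L ((X - C a) * (C b - X)) i S) :
    let A := L (1 * (P * P))
    let B := L ((X - C a) * (Q * Q))
    let C' := L ((C b - X) * (R * R))
    let D := L ((X - C a) * (C b - X) * (S * S))
    (A + D) * (B + C') = (b - a) * (C' * B) := by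
  intro A B C' D
  have hXS : (X * S).coeff (i + 1) = 1 := by rw [coeff_X_mul, hS.coeff_self]
  have hS0 : S.coeff (i + 1) = 0 :=
    coeff_eq_zero_of_natDegree_lt (hS.natDegree_le.trans_lt (Nat.lt_succ_self _))
  -- As in the even case: pairing with `Q` and `R` gives `A + D = α B` and `A + D = β C'` with `α +
  -- β = b - a`.
  have hF : (P + (C b - X) * S).natDegree ≤ i := by
    refine natDegree_le_of_coeff_succ ((natDegree_add_le _ _).trans
      (max_le hP.natDegree_le (natDegree_C_sub_X_mul_le hS.natDegree_le b))) ?_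
    rw [coeff_add, sub_mul, coeff_sub, hXS, coeff_C_mul, hS0, hP.coeff_self]
    ring
  have hG : ((X - C a) * S - P).natDegree ≤ i := by
    refine natDegree_le_of_coeff_succ ((natDegree_sub_le _ _).trans
      (max_le (natDegree_X_sub_C_mul_le hS.natDegree_le a) hP.natDegree_le)) ?_
    rw [coeff_sub, sub_mul, coeff_sub, hXS, coeff_C_mul, hS0, hP.coeff_self]
    ring
  have h1 := hQ.apply_mul hF
  have h2 := hR.apply_mul hG
  have e1 : (X - C a) * (Q * (P + (C b - X) * S))
      = 1 * (P * ((X - C a) * Q)) + (X - C a) * (C b - X) * (S * Q) := by ring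
  have e2 : (C b - X) * (R * ((X - C a) * S - P))
      = (X - C a) * (C b - X) * (S * R) - 1 * (P * ((C b - X) * R)) := by ring
  rw [e1, map_add, hP.apply_mul (natDegree_X_sub_C_mul_le hQ.natDegree_le a),
    hS.apply_mul hQ.natDegree_le, hQ.coeff_self, coeff_X_sub_C_mul', coeff_X_mul,
    hQ.coeff_self, coeff_eq_zero_of_natDegree_lt (hQ.natDegree_le.trans_lt (Nat.lt_succ_self _)),
    coeff_add, coeff_C_sub_X_mul, hS.coeff_self] at h1
  rw [e2, map_sub, hP.apply_mul (natDegree_C_sub_X_mul_le hR.natDegree_le b),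
    hS.apply_mul hR.natDegree_le, hR.coeff_self, coeff_C_sub_X_mul, coeff_X_mul,
    hR.coeff_self, coeff_eq_zero_of_natDegree_lt (hR.natDegree_le.trans_lt (Nat.lt_succ_self _)),
    coeff_sub, coeff_X_sub_C_mul', hS.coeff_self] at h2
  change (1 - a * 0) * A + 1 * D = _ * B at h1
  change 1 * D - (b * 0 - 1) * A = _ * C' at h2
  linear_combination C' * h1 + B * h2

end Recursion

/-! ### Moment functionals, extensions of a moment vector, strict positivity -/

section Functional

open Polynomial

variable {a b : ℝ}

/-- The linear functional `p ↦ ∫ p dμ` on polynomials, written in terms of the moments of `μ`. -/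
def momentFunctional (μ : Measure ℝ) : ℝ[X] →ₗ[ℝ] ℝ :=
  Polynomial.lsum fun i => powerMoment μ i • LinearMap.id

lemma momentFunctional_apply (μ : Measure ℝ) (p : ℝ[X]) :
    momentFunctional μ p = p.sum fun i c => powerMoment μ i * c := by
  simp [momentFunctional, Polynomial.lsum_apply]

lemma IsProbOn.integrable {μ : Measure ℝ} (hμ : IsProbOn a b μ) {g : ℝ → ℝ} (hg : Continuous g) :
    Integrable g μ := by
  have := hμ.1
  have h : μ.restrict (Icc a b) = μ :=
    Measure.restrict_eq_self_of_ae_mem (by rw [ae_iff]; exact hμ.2)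
  rw [← h]
  exact hg.continuousOn.integrableOn_compact isCompact_Icc

lemma IsProbOn.ae_mem {μ : Measure ℝ} (hμ : IsProbOn a b μ) : ∀ᵐ t ∂μ, t ∈ Icc a b := by
  rw [ae_iff]; exact hμ.2

lemma powerMoment_zero {μ : Measure ℝ} (hμ : IsProbOn a b μ) : powerMoment μ 0 = 1 := by
  have := hμ.1
  simp [powerMoment]

lemma IsProbOn.momentFunctional_eq {μ : Measure ℝ} (hμ : IsProbOn a b μ) (p : ℝ[X]) :
    momentFunctional μ p = ∫ t, p.eval t ∂μ := by
  rw [momentFunctional_apply]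
  simp only [eval_eq_sum, Polynomial.sum]
  rw [integral_finsetSum _ fun i _ => hμ.integrable (by fun_prop)]
  refine Finset.sum_congr rfl fun i _ => ?_
  rw [integral_const_mul, mul_comm]
  rfl

lemma IsProbOn.momentFunctional_one {μ : Measure ℝ} (hμ : IsProbOn a b μ) :
    momentFunctional μ 1 = 1 := by
  have := hμ.1
  rw [hμ.momentFunctional_eq]
  simp

lemma IsProbOn.momentFunctional_nonneg {μ : Measure ℝ} (hμ : IsProbOn a b μ) {p : ℝ[X]}
    (hp : ∀ t ∈ Icc a b, 0 ≤ p.eval t) : 0 ≤ momentFunctional μ p := by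
  rw [hμ.momentFunctional_eq]
  exact integral_nonneg_of_ae (hμ.ae_mem.mono fun t ht => hp t ht)

/-- Measures with the same moments of order less than `k` differ on a polynomial of degree at most
`k` only through its coefficient of order `k`. -/
lemma momentFunctional_sub {μ ν : Measure ℝ} {k : ℕ}
    (h : ∀ i < k, powerMoment ν i = powerMoment μ i) {p : ℝ[X]} (hp : p.natDegree ≤ k) :
    momentFunctional ν p - momentFunctional μ p
      = p.coeff k * (powerMoment ν k - powerMoment μ k) := by
  rw [momentFunctional_apply, momentFunctional_apply,
    sum_over_range' p (by simp) (k + 1) (Nat.lt_succ_of_le hp),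
    sum_over_range' p (by simp) (k + 1) (Nat.lt_succ_of_le hp), Finset.sum_range_succ,
    Finset.sum_range_succ, Finset.sum_congr rfl fun i hi => by
      rw [h i (Finset.mem_range.1 hi)]]
  ring

/-- All values of the moment of order `n + 1` of a probability measure on `[a,b]` whose moments of
order `1, …, n` are the components of `m`. -/
def momentExtensions (a b : ℝ) {n : ℕ} (m : Fin n → ℝ) : Set ℝ :=
  {x | ∃ μ : Measure ℝ, IsProbOn a b μ ∧ (∀ i : Fin n, powerMoment μ (i + 1) = m i) ∧
    powerMoment μ (n + 1) = x}

/-- The vectors all of whose canonical moments are defined. -/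
def interiorMoments (a b : ℝ) (n : ℕ) : Set (Fin n → ℝ) :=
  {m | ∀ k, lowerMoment a b m k < m k ∧ m k < upperMoment a b m k}

variable {n : ℕ} {m : Fin n → ℝ}

/-- The range of a moment depends only on the earlier components. Splitting off the last one with
`Fin.snoc` therefore permits induction on `n`. -/
lemma nextMoments_snoc_last (m : Fin n → ℝ) (x : ℝ) :
    nextMoments a b (Fin.snoc m x : Fin (n + 1) → ℝ) (Fin.last n) = momentExtensions a b m := by
  ext y
  refine exists_congr fun μ => and_congr_right fun _ => and_congr ⟨fun h i => ?_, fun h i hi => ?_⟩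
    (by simp)
  · simpa using h i.castSucc (Fin.castSucc_lt_last i)
  · obtain ⟨j, rfl⟩ := Fin.exists_castSucc_eq.2 hi.ne
    simpa using h j

lemma nextMoments_snoc_castSucc (m : Fin n → ℝ) (x : ℝ) (k : Fin n) :
    nextMoments a b (Fin.snoc m x : Fin (n + 1) → ℝ) k.castSucc = nextMoments a b m k := by
  ext y
  refine exists_congr fun μ => and_congr_right fun _ => and_congr ⟨fun h i hi => ?_, fun h i hi => ?_⟩
    (by simp)
  · simpa using h i.castSucc (by simpa using hi)
  · obtain ⟨j, rfl⟩ := Fin.exists_castSucc_eq.2 (hi.trans (Fin.castSucc_lt_last k)).ne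
    simpa using h j (by simpa using hi)

lemma snoc_mem_interiorMoments {x : ℝ} :
    (Fin.snoc m x : Fin (n + 1) → ℝ) ∈ interiorMoments a b (n + 1) ↔
      m ∈ interiorMoments a b n ∧
        sInf (momentExtensions a b m) < x ∧ x < sSup (momentExtensions a b m) := by
  simp only [interiorMoments, mem_ofPred_eq, Fin.forall_fin_succ', lowerMoment, upperMoment,
    nextMoments_snoc_last, nextMoments_snoc_castSucc, Fin.snoc_castSucc, Fin.snoc_last]

lemma IsProbOn.combo {μ ν : Measure ℝ} (hμ : IsProbOn a b μ) (hν : IsProbOn a b ν) {s t : ℝ}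
    (hs : 0 ≤ s) (ht : 0 ≤ t) (hst : s + t = 1) :
    ∃ ρ : Measure ℝ, IsProbOn a b ρ ∧
      ∀ k, powerMoment ρ k = s * powerMoment μ k + t * powerMoment ν k := by
  have := hμ.1
  have := hν.1
  refine ⟨ENNReal.ofReal s • μ + ENNReal.ofReal t • ν, ⟨⟨?_⟩, ?_⟩, fun k => ?_⟩
  · simp [← ENNReal.ofReal_add hs ht, hst]
  · simp [hμ.2, hν.2]
  · have hi := hμ.integrable (continuous_pow k)
    have hj := hν.integrable (continuous_pow k)
    rw [powerMoment, integral_add_measure (hi.smul_measure (by simp)) (hj.smul_measure (by simp)),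
      integral_smul_measure, integral_smul_measure, ENNReal.toReal_ofReal hs,
      ENNReal.toReal_ofReal ht]
    rfl

lemma IsProbOn.powerMoment_mem {μ : Measure ℝ} (hμ : IsProbOn a b μ) (k : ℕ) :
    |powerMoment μ k| ≤ (max |a| |b|) ^ k := by
  have := hμ.1
  have h : ‖∫ t, t ^ k ∂μ‖ ≤ (max |a| |b|) ^ k * μ.real univ :=
    norm_integral_le_of_norm_le_const (hμ.ae_mem.mono fun t ht => ?_)
  · simpa [powerMoment] using h
  rw [norm_pow, Real.norm_eq_abs]
  exact pow_le_pow_left₀ (abs_nonneg t) (abs_le_max_abs_abs ht.1 ht.2) k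

lemma bddBelow_momentExtensions (m : Fin n → ℝ) : BddBelow (momentExtensions a b m) :=
  ⟨-(max |a| |b|) ^ (n + 1), fun _ ⟨_, hμ, _, h⟩ => h ▸ (abs_le.1 (hμ.powerMoment_mem _)).1⟩

lemma bddAbove_momentExtensions (m : Fin n → ℝ) : BddAbove (momentExtensions a b m) :=
  ⟨(max |a| |b|) ^ (n + 1), fun _ ⟨_, hμ, _, h⟩ => h ▸ (abs_le.1 (hμ.powerMoment_mem _)).2⟩

lemma convex_momentExtensions (m : Fin n → ℝ) : Convex ℝ (momentExtensions a b m) := by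
  rintro x ⟨μ, hμ, h1, rfl⟩ y ⟨ν, hν, h2, rfl⟩ s t hs ht hst
  obtain ⟨ρ, hρ, h⟩ := hμ.combo hν hs ht hst
  exact ⟨ρ, hρ, fun i => by rw [h, h1, h2, ← add_mul, hst, one_mul], h _⟩

lemma mem_momentExtensions_of_lt {x : ℝ} (h1 : sInf (momentExtensions a b m) < x)
    (h2 : x < sSup (momentExtensions a b m)) : x ∈ momentExtensions a b m := by
  have hne : (momentExtensions a b m).Nonempty := by
    -- For the empty set `sInf` and `sSup` are both `0`, which contradicts the strict inequalities.
    by_contra h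
    rw [not_nonempty_iff_eq_empty] at h
    rw [h] at h1 h2
    simp only [Real.sInf_empty, Real.sSup_empty] at h1 h2
    exact lt_asymm h1 h2
  obtain ⟨y, hy, hyx⟩ := exists_lt_of_csInf_lt hne h1
  obtain ⟨z, hz, hxz⟩ := exists_lt_of_lt_csSup hne h2
  exact (convex_momentExtensions m).ordConnected.out hy hz ⟨hyx.le, hxz.le⟩

lemma mem_momentSpace_snoc {x : ℝ} (h : x ∈ momentExtensions a b m) :
    (Fin.snoc m x : Fin (n + 1) → ℝ) ∈ momentSpace a b (n + 1) := by
  obtain ⟨μ, hμ, h1, h2⟩ := h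
  refine ⟨μ, hμ, fun i => ?_⟩
  refine Fin.lastCases ?_ (fun i => ?_) i
  · simpa using h2
  · simpa using h1 i

lemma interiorMoments_subset_momentSpace (hab : a ≤ b) :
    interiorMoments a b n ⊆ momentSpace a b n := by
  intro m hm
  cases n with
  | zero =>
    refine ⟨Measure.dirac a, ⟨inferInstance, ?_⟩, fun i => i.elim0⟩
    rw [Measure.dirac_apply' _ measurableSet_Icc.compl, indicator_of_notMem (by simpa using hab)]
  | succ n =>
    rw [← Fin.snoc_init_self m, snoc_mem_interiorMoments] at hm
    rw [← Fin.snoc_init_self m]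
    exact mem_momentSpace_snoc (mem_momentExtensions_of_lt hm.2.1 hm.2.2)

/-- If a nonnegative `p` of degree `j + 1` had integral zero, then over measures sharing the first
`j` moments its integral would be the leading coefficient times the change in the next moment.
Nonnegativity would make `m_{j+1}` an endpoint of its range. -/
lemma posBelow_momentFunctional {μ : Measure ℝ} (hμ : IsProbOn a b μ)
    (hm : (fun i : Fin n => powerMoment μ (i + 1)) ∈ interiorMoments a b n) :
    PosBelow a b (momentFunctional μ) (n + 1) := by
  intro p hp hdeg hnn
  refine (hμ.momentFunctional_nonneg hnn).lt_of_ne' fun h0 => ?_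
  obtain ⟨j, hj⟩ | h := (Nat.eq_zero_or_eq_succ_pred p.natDegree).symm.imp_left
    fun h => (⟨_, h⟩ : ∃ j, p.natDegree = j + 1)
  · have hjn : j < n := by omega
    set k : Fin n := ⟨j, hjn⟩
    have hmem : powerMoment μ (j + 1) ∈
        nextMoments a b (fun i : Fin n => powerMoment μ (i + 1)) k :=
      ⟨μ, hμ, fun i _ => rfl, rfl⟩
    have key : ∀ x ∈ nextMoments a b (fun i : Fin n => powerMoment μ (i + 1)) k,
        0 ≤ p.leadingCoeff * (x - powerMoment μ (j + 1)) := by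
      rintro x ⟨ν, hν, h1, rfl⟩
      have h2 := momentFunctional_sub (μ := μ) (ν := ν) (k := j + 1) (p := p) (fun i hi => ?_) hj.le
      · rw [h0, sub_zero, ← hj] at h2
        rw [leadingCoeff, ← hj]
        rw [← h2]
        exact hν.momentFunctional_nonneg hnn
      · cases i with
        | zero => rw [powerMoment_zero hμ, powerMoment_zero hν]
        | succ i => exact h1 ⟨i, by omega⟩ (by rw [Fin.lt_def]; simp only [k]; omega)
    rcases lt_or_gt_of_ne (leadingCoeff_ne_zero.2 hp) with hc | hc
    · refine absurd (hm k).2 (not_lt.2 (csSup_le ⟨_, hmem⟩ fun x hx => ?_))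
      have := key x hx
      change x ≤ powerMoment μ (j + 1)
      nlinarith
    · refine absurd (hm k).1 (not_lt.2 (le_csInf ⟨_, hmem⟩ fun x hx => ?_))
      have := key x hx
      change powerMoment μ (j + 1) ≤ x
      nlinarith
  · rw [eq_C_of_natDegree_eq_zero h] at h0 hnn hp
    have h1 := hμ.momentFunctional_one
    rw [← mul_one (C (p.coeff 0)), ← smul_eq_C_mul, map_smul, h1] at h0
    simp only [smul_eq_mul, mul_one] at h0
    exact hp (by rw [h0, C_0])

end Functional

/-! ### The width of the range of the next moment -/

section Width

open Polynomial

variable {a b : ℝ} {n : ℕ} {m : Fin n → ℝ} {μ : Measure ℝ}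

/-- `w O²` has degree `n + 1` and leading coefficient `edgeSign b T`, so its integral over an
extension of `m` is affine in the next moment. It is nonnegative, and zero for the Gauss quadrature
measure. -/
lemma exists_orthogonal_extremal (hab : a < b) (hμ : IsProbOn a b μ)
    (hm : ∀ i : Fin n, powerMoment μ (i + 1) = m i)
    (hpos : PosBelow a b (momentFunctional μ) (n + 1)) {T : Finset ℝ} (hT : T ⊆ {a, b}) {d : ℕ}
    (hk : T.card + 2 * d = n + 1) :
    ∃ O : ℝ[X], IsOrthogonal (momentFunctional μ) (edgeWeight b T) d O ∧
      (∀ x ∈ momentExtensions a b m, 0 ≤ momentFunctional μ (edgeWeight b T * (O * O))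
        + edgeSign b T * (x - powerMoment μ (n + 1))) ∧
      ∃ x ∈ momentExtensions a b m, momentFunctional μ (edgeWeight b T * (O * O))
        + edgeSign b T * (x - powerMoment μ (n + 1)) = 0 := by
  rw [← hk] at hpos
  obtain ⟨O, hO, hd, horth⟩ := hpos.exists_orthogonal hT
  have hOO : O * O ≠ 0 := mul_ne_zero hO.ne_zero hO.ne_zero
  have hdeg : (edgeWeight b T * (O * O)).natDegree = n + 1 := by
    rw [natDegree_mul (edgeWeight_ne_zero T) hOO, natDegree_mul hO.ne_zero hO.ne_zero,
      natDegree_edgeWeight, hd]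
    omega
  have hcoeff : (edgeWeight b T * (O * O)).coeff (n + 1) = edgeSign b T := by
    rw [← hdeg, coeff_natDegree, leadingCoeff_mul, leadingCoeff_mul, hO.leadingCoeff,
      leadingCoeff_edgeWeight, mul_one, mul_one]
  have hdiff : ∀ ν : Measure ℝ, IsProbOn a b ν → (∀ i : Fin n, powerMoment ν (i + 1) = m i) →
      momentFunctional ν (edgeWeight b T * (O * O)) =
        momentFunctional μ (edgeWeight b T * (O * O))
          + edgeSign b T * (powerMoment ν (n + 1) - powerMoment μ (n + 1)) := by
    intro ν hν h
    have := momentFunctional_sub (μ := μ) (ν := ν) (k := n + 1) (fun i hi => ?_) hdeg.le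
    · rw [hcoeff] at this
      linarith
    · cases i with
      | zero => rw [powerMoment_zero hμ, powerMoment_zero hν]
      | succ i => exact (h ⟨i, by omega⟩).trans (hm ⟨i, by omega⟩).symm
  refine ⟨O, ⟨hO, hd, horth⟩, ?_, ?_⟩
  · rintro x ⟨ν, hν, h1, rfl⟩
    rw [← hdiff ν hν h1]
    refine hν.momentFunctional_nonneg fun t ht => ?_
    rw [eval_mul, eval_mul]
    exact mul_nonneg (eval_edgeWeight_nonneg hT ht) (mul_self_nonneg _)
  · obtain ⟨ν, hν, hquad, hzero⟩ :=
      hpos.exists_quadrature hab hT (by omega) hμ.momentFunctional_one hO hd horth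
    have h1 : ∀ i : Fin n, powerMoment ν (i + 1) = m i := by
      intro i
      have h := hquad (X ^ ((i : ℕ) + 1)) (by rw [natDegree_X_pow]; omega)
      rw [hμ.momentFunctional_eq] at h
      simp only [eval_pow, eval_X] at h
      exact h.trans (hm i)
    refine ⟨_, ⟨ν, hν, h1, rfl⟩, ?_⟩
    rw [← hdiff ν hν h1, hν.momentFunctional_eq, hzero]

/-- With sign `1` the inequality bounds the next moment from below and the quadrature measure
attains the minimum; sign `-1` gives the maximum. -/
lemma exists_orthogonal_lower (hab : a < b) (hμ : IsProbOn a b μ)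
    (hm : ∀ i : Fin n, powerMoment μ (i + 1) = m i)
    (hpos : PosBelow a b (momentFunctional μ) (n + 1)) {T : Finset ℝ} (hT : T ⊆ {a, b}) {d : ℕ}
    (hk : T.card + 2 * d = n + 1) (hsign : edgeSign b T = 1) :
    ∃ O : ℝ[X], IsOrthogonal (momentFunctional μ) (edgeWeight b T) d O ∧
      powerMoment μ (n + 1) - sInf (momentExtensions a b m)
        = momentFunctional μ (edgeWeight b T * (O * O)) := by
  obtain ⟨O, hO, hle, x, hx, hx0⟩ := exists_orthogonal_extremal hab hμ hm hpos hT hk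
  refine ⟨O, hO, ?_⟩
  have hleast : IsLeast (momentExtensions a b m) x := ⟨hx, fun y hy => by
    have := hle y hy
    rw [hsign] at this hx0
    linarith⟩
  rw [hleast.csInf_eq]
  rw [hsign] at hx0
  linarith

lemma exists_orthogonal_upper (hab : a < b) (hμ : IsProbOn a b μ)
    (hm : ∀ i : Fin n, powerMoment μ (i + 1) = m i)
    (hpos : PosBelow a b (momentFunctional μ) (n + 1)) {T : Finset ℝ} (hT : T ⊆ {a, b}) {d : ℕ}
    (hk : T.card + 2 * d = n + 1) (hsign : edgeSign b T = -1) :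
    ∃ O : ℝ[X], IsOrthogonal (momentFunctional μ) (edgeWeight b T) d O ∧
      sSup (momentExtensions a b m) - powerMoment μ (n + 1)
        = momentFunctional μ (edgeWeight b T * (O * O)) := by
  obtain ⟨O, hO, hle, x, hx, hx0⟩ := exists_orthogonal_extremal hab hμ hm hpos hT hk
  refine ⟨O, hO, ?_⟩
  have hgreatest : IsGreatest (momentExtensions a b m) x := ⟨hx, fun y hy => by
    have := hle y hy
    rw [hsign] at this hx0
    linarith⟩
  rw [hgreatest.csSup_eq]
  rw [hsign] at hx0
  linarith

/-- The length of the range of the next moment. -/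
def momentWidth (a b : ℝ) {n : ℕ} (m : Fin n → ℝ) : ℝ :=
  sSup (momentExtensions a b m) - sInf (momentExtensions a b m)

lemma edgeWeight_empty : edgeWeight b ∅ = 1 := by simp [edgeWeight]

lemma edgeWeight_left (hab : a ≠ b) : edgeWeight b {a} = X - C a := by
  simp [edgeWeight, edgeFactor, hab]

lemma edgeWeight_right : edgeWeight b {b} = C b - X := by
  simp [edgeWeight, edgeFactor]

lemma edgeWeight_pair (hab : a ≠ b) : edgeWeight b {a, b} = (X - C a) * (C b - X) := by
  simp [edgeWeight, edgeFactor, hab, Finset.prod_pair hab]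

/-- All four distances to the bounds at two consecutive levels are squared norms. An odd moment
order uses the weights of `{a}` and `{b}`, an even one those of `∅` and `{a, b}`, so the parity of
`n` selects the identity. -/
lemma momentWidth_snoc (hab : a < b) {x : ℝ}
    (hmx : (Fin.snoc m x : Fin (n + 1) → ℝ) ∈ interiorMoments a b (n + 1)) :
    momentWidth a b (Fin.snoc m x : Fin (n + 1) → ℝ) * momentWidth a b m
      = (b - a) * ((sSup (momentExtensions a b m) - x) * (x - sInf (momentExtensions a b m))) := by
  obtain ⟨μ, hμ, hm'⟩ := interiorMoments_subset_momentSpace hab.le hmx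
  have hfun : (fun i : Fin (n + 1) => powerMoment μ (i + 1)) = Fin.snoc m x := funext hm'
  have hpos := posBelow_momentFunctional hμ (hfun ▸ hmx)
  have hpos' := hpos.mono (Nat.le_succ _)
  have hm : ∀ i : Fin n, powerMoment μ (i + 1) = m i := fun i => by
    simpa using hm' i.castSucc
  have hx : powerMoment μ (n + 1) = x := by simpa using hm' (Fin.last n)
  have hne := hab.ne
  have ha : ({a} : Finset ℝ) ⊆ {a, b} := by simp
  have hb : ({b} : Finset ℝ) ⊆ {a, b} := by simp
  have hcard : ({a, b} : Finset ℝ).card = 2 := Finset.card_pair hne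
  have hsign : edgeSign b {a, b} = -1 := by
    rw [edgeSign, Finset.prod_pair hne, if_neg hne, if_pos rfl, one_mul]
  have hsign' : edgeSign b {a} = 1 := by rw [edgeSign, Finset.prod_singleton, if_neg hne]
  -- At the higher level `y` is the next moment of the chosen `μ`, which the vector does not
  -- prescribe; the width does not depend on it.
  have hsplit : ∀ {j : ℕ} (y : ℝ) (v : Fin j → ℝ), momentWidth a b v =
      (y - sInf (momentExtensions a b v)) + (sSup (momentExtensions a b v) - y) := fun y v => by
    rw [momentWidth]; ring
  rcases Nat.even_or_odd' n with ⟨i, rfl | rfl⟩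
  · obtain ⟨Q, hQ, eQ⟩ := exists_orthogonal_lower hab hμ hm hpos' ha (d := i)
      (by rw [Finset.card_singleton]; omega) hsign'
    obtain ⟨R, hR, eR⟩ := exists_orthogonal_upper hab hμ hm hpos' hb (d := i)
      (by rw [Finset.card_singleton]; omega) (by simp [edgeSign])
    obtain ⟨P, hP, eP⟩ := exists_orthogonal_lower hab hμ hm' hpos (Finset.empty_subset _)
      (d := i + 1) (by rw [Finset.card_empty]; omega) (by simp [edgeSign])
    obtain ⟨S, hS, eS⟩ := exists_orthogonal_upper hab hμ hm' hpos (Finset.Subset.refl _) (d := i)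
      (by rw [hcard]; omega) hsign
    rw [edgeWeight_left hne] at hQ eQ
    rw [edgeWeight_right] at hR eR
    rw [edgeWeight_empty] at hP eP
    rw [edgeWeight_pair hne] at hS eS
    have h := orthogonal_recursion_odd hP hQ hR hS
    simp only [← eP, ← eQ, ← eR, ← eS, ← hsplit] at h
    rwa [hx] at h
  · obtain ⟨P, hP, eP⟩ := exists_orthogonal_lower hab hμ hm hpos' (Finset.empty_subset _)
      (d := i + 1) (by rw [Finset.card_empty]; omega) (by simp [edgeSign])
    obtain ⟨S, hS, eS⟩ := exists_orthogonal_upper hab hμ hm hpos' (Finset.Subset.refl _) (d := i)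
      (by rw [hcard]; omega) hsign
    obtain ⟨Q, hQ, eQ⟩ := exists_orthogonal_lower hab hμ hm' hpos ha (d := i + 1)
      (by rw [Finset.card_singleton]; omega) hsign'
    obtain ⟨R, hR, eR⟩ := exists_orthogonal_upper hab hμ hm' hpos hb (d := i + 1)
      (by rw [Finset.card_singleton]; omega) (by simp [edgeSign])
    rw [edgeWeight_left hne] at hQ eQ
    rw [edgeWeight_right] at hR eR
    rw [edgeWeight_empty] at hP eP
    rw [edgeWeight_pair hne] at hS eS
    have h := orthogonal_recursion_even hP hQ hR hS
    simp only [← eP, ← eQ, ← eR, ← eS, ← hsplit] at h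
    rwa [hx] at h

lemma momentExtensions_zero (m : Fin 0 → ℝ) : momentExtensions a b m = Icc a b := by
  ext x
  constructor
  · rintro ⟨μ, hμ, -, rfl⟩
    have := hμ.1
    have hi := hμ.integrable continuous_id
    simp only [powerMoment, zero_add, pow_one]
    constructor
    · have := integral_mono_ae (integrable_const a) hi (hμ.ae_mem.mono fun t ht => ht.1)
      simpa using this
    · have := integral_mono_ae hi (integrable_const b) (hμ.ae_mem.mono fun t ht => ht.2)
      simpa using this
  · intro hx
    refine ⟨Measure.dirac x, ⟨inferInstance, ?_⟩, fun i => i.elim0, by simp [powerMoment]⟩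
    rw [Measure.dirac_apply' _ measurableSet_Icc.compl, indicator_of_notMem (by simpa using hx)]

lemma momentWidth_zero (hab : a ≤ b) (m : Fin 0 → ℝ) : momentWidth a b m = b - a := by
  rw [momentWidth, momentExtensions_zero, csSup_Icc hab, csInf_Icc hab]

lemma canonicalMoment_snoc_last (m : Fin n → ℝ) (x : ℝ) :
    canonicalMoment a b (Fin.snoc m x : Fin (n + 1) → ℝ) (Fin.last n)
      = (x - sInf (momentExtensions a b m)) / momentWidth a b m := by
  simp [canonicalMoment, lowerMoment, upperMoment, nextMoments_snoc_last, momentWidth]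

lemma canonicalMoment_snoc_castSucc (m : Fin n → ℝ) (x : ℝ) (k : Fin n) :
    canonicalMoment a b (Fin.snoc m x : Fin (n + 1) → ℝ) k.castSucc = canonicalMoment a b m k := by
  simp [canonicalMoment, lowerMoment, upperMoment, nextMoments_snoc_castSucc]

/-- The range of the next moment in terms of the canonical moments. -/
lemma momentWidth_eq (hab : a < b) {n : ℕ} {m : Fin n → ℝ} (hm : m ∈ interiorMoments a b n) :
    momentWidth a b m = (b - a) ^ (n + 1)
      * ∏ k : Fin n, (canonicalMoment a b m k - canonicalMoment a b m k ^ 2) := by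
  induction n with
  | zero => simp [momentWidth_zero hab.le]
  | succ n ih =>
    obtain ⟨v, x, rfl⟩ : ∃ (v : Fin n → ℝ) (x : ℝ), m = Fin.snoc v x :=
      ⟨_, _, (Fin.snoc_init_self m).symm⟩
    have h := momentWidth_snoc hab hm
    obtain ⟨hv, h1, h2⟩ := snoc_mem_interiorMoments.1 hm
    have hw : momentWidth a b v ≠ 0 := by rw [momentWidth]; linarith
    rw [Fin.prod_univ_castSucc]
    simp only [canonicalMoment_snoc_castSucc, canonicalMoment_snoc_last]
    have hp : (b - a) ^ (n + 1 + 1) * ((∏ k : Fin n, (canonicalMoment a b v k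
        - canonicalMoment a b v k ^ 2)) * ((x - sInf (momentExtensions a b v)) / momentWidth a b v
        - ((x - sInf (momentExtensions a b v)) / momentWidth a b v) ^ 2))
        = (b - a) * momentWidth a b v * ((x - sInf (momentExtensions a b v)) / momentWidth a b v
        - ((x - sInf (momentExtensions a b v)) / momentWidth a b v) ^ 2) := by
      rw [ih hv]; ring
    rw [hp]
    have hs : sSup (momentExtensions a b v) - x =
        momentWidth a b v - (x - sInf (momentExtensions a b v)) := by rw [momentWidth]; ring
    rw [hs] at h
    field_simp
    linarith

end Width

/-! ### Continuity of the moment bounds and of the canonical moments -/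

section Continuity

variable {a b : ℝ} {n : ℕ}

lemma convex_momentSpace : Convex ℝ (momentSpace a b n) := by
  rintro x ⟨μ, hμ, h1⟩ y ⟨ν, hν, h2⟩ s t hs ht hst
  obtain ⟨ρ, hρ, h⟩ := hμ.combo hν hs ht hst
  exact ⟨ρ, hρ, fun i => by simp [h, h1, h2]⟩

lemma momentExtensions_nonempty {m : Fin n → ℝ} (hm : m ∈ momentSpace a b n) :
    (momentExtensions a b m).Nonempty := by
  obtain ⟨μ, hμ, h⟩ := hm
  exact ⟨_, μ, hμ, h, rfl⟩

lemma combo_mem_momentExtensions {m m' : Fin n → ℝ} {x y s t : ℝ}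
    (hx : x ∈ momentExtensions a b m) (hy : y ∈ momentExtensions a b m')
    (hs : 0 ≤ s) (ht : 0 ≤ t) (hst : s + t = 1) :
    s * x + t * y ∈ momentExtensions a b (s • m + t • m') := by
  obtain ⟨μ, hμ, h1, rfl⟩ := hx
  obtain ⟨ν, hν, h2, rfl⟩ := hy
  obtain ⟨ρ, hρ, h⟩ := hμ.combo hν hs ht hst
  exact ⟨ρ, hρ, fun i => by simp [h, h1, h2], h _⟩

/-- Mixtures of extensions extend the mixed vector. The resulting convexity yields continuity on
open sets. -/
lemma convexOn_sInf_momentExtensions :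
    ConvexOn ℝ (momentSpace a b n) fun m => sInf (momentExtensions a b m) := by
  refine ⟨convex_momentSpace, fun m hm m' hm' s t hs ht hst => ?_⟩
  refine le_of_forall_pos_le_add fun ε hε => ?_
  obtain ⟨x, hx, hxε⟩ := exists_lt_of_csInf_lt (momentExtensions_nonempty hm)
    (lt_add_of_pos_right _ hε)
  obtain ⟨y, hy, hyε⟩ := exists_lt_of_csInf_lt (momentExtensions_nonempty hm')
    (lt_add_of_pos_right _ hε)
  refine (csInf_le (bddBelow_momentExtensions _)
    (combo_mem_momentExtensions hx hy hs ht hst)).trans ?_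
  simp only [smul_eq_mul]
  nlinarith [mul_le_mul_of_nonneg_left hxε.le hs, mul_le_mul_of_nonneg_left hyε.le ht]

lemma concaveOn_sSup_momentExtensions :
    ConcaveOn ℝ (momentSpace a b n) fun m => sSup (momentExtensions a b m) := by
  refine ⟨convex_momentSpace, fun m hm m' hm' s t hs ht hst => ?_⟩
  refine le_of_forall_pos_le_add fun ε hε => ?_
  obtain ⟨x, hx, hxε⟩ := exists_lt_of_lt_csSup (momentExtensions_nonempty hm)
    (sub_lt_self _ hε)
  obtain ⟨y, hy, hyε⟩ := exists_lt_of_lt_csSup (momentExtensions_nonempty hm')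
    (sub_lt_self _ hε)
  have := le_csSup (bddAbove_momentExtensions _)
    (combo_mem_momentExtensions hx hy hs ht hst)
  simp only [smul_eq_mul]
  nlinarith [mul_le_mul_of_nonneg_left hxε.le hs, mul_le_mul_of_nonneg_left hyε.le ht]

lemma interiorMoments_succ_eq : interiorMoments a b (n + 1) =
    {m | (Fin.init m : Fin n → ℝ) ∈ interiorMoments a b n ∧
      sInf (momentExtensions a b (Fin.init m : Fin n → ℝ)) < m (Fin.last n) ∧
      m (Fin.last n) < sSup (momentExtensions a b (Fin.init m : Fin n → ℝ))} := by
  ext m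
  conv_lhs => rw [← Fin.snoc_init_self m, snoc_mem_interiorMoments]
  rfl

lemma continuousOn_sInf_momentExtensions (hab : a ≤ b) (h : IsOpen (interiorMoments a b n)) :
    ContinuousOn (fun m : Fin n → ℝ => sInf (momentExtensions a b m)) (interiorMoments a b n) :=
  convexOn_sInf_momentExtensions.continuousOn_interior.mono
    (interior_maximal (interiorMoments_subset_momentSpace hab) h)

lemma continuousOn_sSup_momentExtensions (hab : a ≤ b) (h : IsOpen (interiorMoments a b n)) :
    ContinuousOn (fun m : Fin n → ℝ => sSup (momentExtensions a b m)) (interiorMoments a b n) :=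
  concaveOn_sSup_momentExtensions.continuousOn_interior.mono
    (interior_maximal (interiorMoments_subset_momentSpace hab) h)

lemma continuous_init : Continuous (Fin.init : (Fin (n + 1) → ℝ) → Fin n → ℝ) :=
  continuous_pi fun i => continuous_apply i.castSucc

/-- Openness at level `n` makes the bounds for the next moment continuous, and these strict bounds
then cut out an open set at level `n + 1`. -/
lemma isOpen_interiorMoments (hab : a ≤ b) (n : ℕ) : IsOpen (interiorMoments a b n) := by
  induction n with
  | zero =>
    convert isOpen_univ
    exact eq_univ_of_forall fun m i => i.elim0
  | succ n ih =>
    rw [interiorMoments_succ_eq]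
    have hU : IsOpen {m : Fin (n + 1) → ℝ | (Fin.init m : Fin n → ℝ) ∈ interiorMoments a b n} :=
      ih.preimage continuous_init
    set U := {m : Fin (n + 1) → ℝ | (Fin.init m : Fin n → ℝ) ∈ interiorMoments a b n} with hUdef
    have h1 : ContinuousOn (fun m : Fin (n + 1) → ℝ =>
        m (Fin.last n) - sInf (momentExtensions a b (Fin.init m : Fin n → ℝ))) U :=
      (continuous_apply (Fin.last n)).continuousOn.sub
        ((continuousOn_sInf_momentExtensions hab ih).comp continuous_init.continuousOn
          fun m hm => hm)
    have h2 : ContinuousOn (fun m : Fin (n + 1) → ℝ =>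
        sSup (momentExtensions a b (Fin.init m : Fin n → ℝ)) - m (Fin.last n)) U :=
      ((continuousOn_sSup_momentExtensions hab ih).comp continuous_init.continuousOn
          fun m hm => hm).sub (continuous_apply (Fin.last n)).continuousOn
    convert (h1.isOpen_inter_preimage hU isOpen_Ioi (t := Ioi 0)).inter
      (h2.isOpen_inter_preimage hU isOpen_Ioi (t := Ioi 0)) using 1
    ext m
    simp only [hUdef, mem_ofPred_eq, mem_inter_iff, mem_preimage, mem_Ioi, sub_pos]
    tauto

lemma continuousOn_canonicalMoment (hab : a ≤ b) (k : Fin n) :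
    ContinuousOn (fun m => canonicalMoment a b m k) (interiorMoments a b n) := by
  induction n with
  | zero => exact k.elim0
  | succ n ih =>
    have hmaps : ∀ m ∈ interiorMoments a b (n + 1),
        (Fin.init m : Fin n → ℝ) ∈ interiorMoments a b n := fun m hm => by
      rw [interiorMoments_succ_eq] at hm
      exact hm.1
    refine Fin.lastCases ?_ (fun k => ?_) k
    · have h1 := (continuousOn_sInf_momentExtensions hab (isOpen_interiorMoments hab n)).comp
        continuous_init.continuousOn hmaps
      have h2 := (continuousOn_sSup_momentExtensions hab (isOpen_interiorMoments hab n)).comp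
        continuous_init.continuousOn hmaps
      refine (((continuous_apply (Fin.last n)).continuousOn.sub h1).div (h2.sub h1)
        fun m hm => ?_).congr fun m hm => ?_
      · rw [interiorMoments_succ_eq] at hm
        exact (sub_pos.2 (hm.2.1.trans hm.2.2)).ne'
      · conv_lhs => rw [← Fin.snoc_init_self m]
        rw [canonicalMoment_snoc_last]
        rfl
    · refine ((ih k).comp continuous_init.continuousOn hmaps).congr fun m hm => ?_
      conv_lhs => rw [← Fin.snoc_init_self m]
      rw [canonicalMoment_snoc_castSucc]
      rfl

lemma canonicalMoment_mem_Ioo {m : Fin n → ℝ} (hm : m ∈ interiorMoments a b n) (k : Fin n) :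
    canonicalMoment a b m k ∈ Ioo 0 1 := by
  obtain ⟨h1, h2⟩ := hm k
  have hw : 0 < upperMoment a b m k - lowerMoment a b m k := by linarith
  exact ⟨div_pos (by linarith) hw, (div_lt_one hw).2 (by linarith)⟩

end Continuity

/-! ### Lebesgue measure in canonical coordinates -/

section Integration

variable {a b : ℝ} {n : ℕ}

lemma measurableSet_interiorMoments (hab : a ≤ b) (n : ℕ) :
    MeasurableSet (interiorMoments a b n) :=
  (isOpen_interiorMoments hab n).measurableSet

/-- Continuity is available only on the open set of interior vectors, hence the indicators here and
below. -/
lemma measurable_indicator_canonicalMoment (hab : a ≤ b) (k : Fin n) :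
    Measurable ((interiorMoments a b n).indicator fun m => canonicalMoment a b m k) := by
  classical
  rw [← piecewise_eq_indicator]
  exact (continuousOn_canonicalMoment hab k).measurable_piecewise continuousOn_const
    (measurableSet_interiorMoments hab n)

lemma measurable_indicator_prod_canonicalMoment (hab : a ≤ b) {g : Fin n → ℝ → ℝ≥0∞}
    (hg : ∀ k, Measurable (g k)) :
    Measurable ((interiorMoments a b n).indicator fun m =>
      ∏ k : Fin n, g k (canonicalMoment a b m k)) := by
  have h : (interiorMoments a b n).indicator (fun m => ∏ k : Fin n, g k (canonicalMoment a b m k))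
      = (interiorMoments a b n).indicator fun m => ∏ k : Fin n, g k
        ((interiorMoments a b n).indicator (fun m => canonicalMoment a b m k) m) :=
    indicator_congr fun m hm => by simp only [indicator_of_mem hm]
  rw [h]
  exact (Finset.measurable_prod _ fun k _ =>
    (hg k).comp (measurable_indicator_canonicalMoment hab k)).indicator
    (measurableSet_interiorMoments hab n)

lemma lintegral_Ioo_affine {l u : ℝ} (hlu : l < u) (h : ℝ → ℝ≥0∞) :
    ∫⁻ x in Ioo l u, h ((x - l) / (u - l)) = ENNReal.ofReal (u - l) * ∫⁻ y in Ioo 0 1, h y := by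
  have hw : 0 < u - l := sub_pos.2 hlu
  have himg : (fun y => l + (u - l) * y) '' Ioo 0 1 = Ioo l u := by
    ext x
    constructor
    · rintro ⟨y, ⟨h0, h1⟩, rfl⟩
      exact ⟨by simp only; nlinarith, by simp only; nlinarith⟩
    · rintro ⟨h0, h1⟩
      refine ⟨(x - l) / (u - l), ⟨div_pos (by linarith) hw, (div_lt_one hw).2 (by linarith)⟩, ?_⟩
      simp only
      field_simp
      ring
  rw [← himg, lintegral_image_eq_lintegral_abs_deriv_mul measurableSet_Ioo
    (f' := fun _ => u - l) (fun y _ => ?_) (fun y _ z _ hyz => ?_), abs_of_pos hw,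
    lintegral_const_mul' _ _ ENNReal.ofReal_ne_top]
  · congr 1
    refine setLIntegral_congr_fun measurableSet_Ioo fun y _ => ?_
    simp only [add_sub_cancel_left, mul_div_cancel_left₀ _ hw.ne']
  · simpa using (((hasDerivAt_id y).const_mul (u - l)).const_add l).hasDerivWithinAt
  · simpa [hw.ne'] using hyz

lemma indicator_interiorMoments_snoc (g : Fin (n + 1) → ℝ → ℝ≥0∞) (v : Fin n → ℝ) (x : ℝ) :
    (interiorMoments a b (n + 1)).indicator
        (fun m => ∏ k, g k (canonicalMoment a b m k)) (Fin.snoc v x)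
      = (interiorMoments a b n).indicator
          (fun v => ∏ k : Fin n, g k.castSucc (canonicalMoment a b v k)) v
        * (Ioo (sInf (momentExtensions a b v)) (sSup (momentExtensions a b v))).indicator
          (fun x => g (Fin.last n) ((x - sInf (momentExtensions a b v)) / momentWidth a b v)) x := by
  classical
  simp only [indicator_apply, snoc_mem_interiorMoments, Fin.prod_univ_castSucc,
    canonicalMoment_snoc_castSucc, canonicalMoment_snoc_last, mem_Ioo]
  split_ifs <;> simp_all

/-- In the coordinates given by the canonical moments, Lebesgue measure on the moment space is a
product measure. -/
theorem lintegral_prod_canonicalMoment (hab : a < b) (n : ℕ) {g : Fin n → ℝ → ℝ≥0∞}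
    (hg : ∀ k, Measurable (g k)) :
    ∫⁻ m, (interiorMoments a b n).indicator (fun m => ∏ k, g k (canonicalMoment a b m k)) m
      = ∏ k : Fin n, (ENNReal.ofReal ((b - a) ^ ((k : ℕ) + 1)) *
          ∫⁻ x in Ioo 0 1, g k x * ENNReal.ofReal (x - x ^ 2) ^ (n - ((k : ℕ) + 1))) := by
  induction n with
  | zero =>
    have : interiorMoments a b 0 = univ := eq_univ_of_forall fun m i => i.elim0
    rw [this]
    simp [volume_pi]
  | succ n ih =>
    have hmeas := measurable_indicator_prod_canonicalMoment hab.le hg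
    have hmp := (volume_preserving_piFinSuccAbove (fun _ : Fin (n + 1) => ℝ) (Fin.last n)).symm
    have hmeas' : Measurable fun z : ℝ × (Fin n → ℝ) => (interiorMoments a b (n + 1)).indicator
        (fun m => ∏ k, g k (canonicalMoment a b m k))
        ((MeasurableEquiv.piFinSuccAbove (fun _ => ℝ) (Fin.last n)).symm z) :=
      hmeas.comp (MeasurableEquiv.measurable _)
    rw [← hmp.lintegral_comp hmeas, Measure.volume_eq_prod, lintegral_prod_symm' _ hmeas']
    -- Integrating out the last coordinate produces the width of its range, which hands one factor
    -- `x - x²` to every earlier coordinate. The induction hypothesis is applied to the functions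
    -- multiplied by it.
    have hstep : ∀ v : Fin n → ℝ,
        ∫⁻ x, (interiorMoments a b (n + 1)).indicator
          (fun m => ∏ k, g k (canonicalMoment a b m k))
          ((MeasurableEquiv.piFinSuccAbove (fun _ => ℝ) (Fin.last n)).symm (x, v))
        = (interiorMoments a b n).indicator (fun v => ∏ k : Fin n,
            (g k.castSucc (canonicalMoment a b v k)
              * ENNReal.ofReal (canonicalMoment a b v k - canonicalMoment a b v k ^ 2))) v
          * (ENNReal.ofReal ((b - a) ^ (n + 1)) * ∫⁻ y in Ioo 0 1, g (Fin.last n) y) := by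
      intro v
      have hsnoc : ∀ x : ℝ, (MeasurableEquiv.piFinSuccAbove (fun _ => ℝ) (Fin.last n)).symm (x, v)
          = (Fin.snoc v x : Fin (n + 1) → ℝ) := fun x => by
        rw [← Fin.insertNth_last']
        rfl
      simp only [hsnoc, indicator_interiorMoments_snoc]
      by_cases hv : v ∈ interiorMoments a b n
      · simp only [indicator_of_mem hv]
        have hw := momentWidth_eq hab hv
        have hp : ∀ k, 0 < canonicalMoment a b v k - canonicalMoment a b v k ^ 2 := fun k => by
          have := canonicalMoment_mem_Ioo hv k
          nlinarith [this.1, this.2]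
        have hwpos : 0 < momentWidth a b v := by
          rw [hw]
          exact mul_pos (pow_pos (sub_pos.2 hab) _) (Finset.prod_pos fun k _ => hp k)
        have hlt : sInf (momentExtensions a b v) < sSup (momentExtensions a b v) := by
          rwa [momentWidth, sub_pos] at hwpos
        have haff := lintegral_Ioo_affine hlt (g (Fin.last n))
        have hmeas2 : Measurable ((Ioo (sInf (momentExtensions a b v))
            (sSup (momentExtensions a b v))).indicator
            (fun x => g (Fin.last n) ((x - sInf (momentExtensions a b v)) / momentWidth a b v))) :=
          ((hg _).comp (by fun_prop)).indicator measurableSet_Ioo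
        rw [lintegral_const_mul _ hmeas2, lintegral_indicator measurableSet_Ioo]
        change _ * ∫⁻ x in Ioo _ _, g (Fin.last n) (_ / (_ - _)) = _
        rw [haff]
        change _ * (ENNReal.ofReal (momentWidth a b v) * _) = _
        rw [hw, ENNReal.ofReal_mul (pow_nonneg (sub_nonneg.2 hab.le) _),
          ENNReal.ofReal_prod_of_nonneg fun k _ => (hp k).le, Finset.prod_mul_distrib]
        ring
      · simp [indicator_of_notMem hv]
    simp only [hstep]
    have hg' : ∀ k : Fin n, Measurable fun x => g k.castSucc x * ENNReal.ofReal (x - x ^ 2) :=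
      fun k => (hg _).mul (by fun_prop)
    rw [lintegral_mul_const _ (measurable_indicator_prod_canonicalMoment hab.le hg'), ih hg',
      Fin.prod_univ_castSucc]
    congr 1
    · refine Finset.prod_congr rfl fun k _ => ?_
      congr 1
      refine lintegral_congr fun x => ?_
      have : n + 1 - ((k.castSucc : ℕ) + 1) = (n - ((k : ℕ) + 1)) + 1 := by
        have := k.2
        simp only [Fin.val_castSucc]
        omega
      rw [this, pow_succ (ENNReal.ofReal _), mul_assoc, mul_comm (ENNReal.ofReal (x - x ^ 2))]
    · simp

end Integration

/-! ### The one-dimensional laws of the canonical moments -/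

section TiltedLaw

variable {h : ℝ → ℝ}

/-- The distribution on `(0,1)` with density proportional to `h(x) (x - x²)^e`. -/
def tiltedLaw (h : ℝ → ℝ) (e : ℕ) : Measure ℝ :=
  (volume.restrict (Ioo 0 1)).withDensity fun x =>
    ENNReal.ofReal ((∫ y in Ioo (0 : ℝ) 1, h y * (y - y ^ 2) ^ e)⁻¹ * (h x * (x - x ^ 2) ^ e))

lemma sub_sq_nonneg_of_mem {x : ℝ} (hx : x ∈ Ioo (0 : ℝ) 1) : 0 ≤ x - x ^ 2 := by
  nlinarith [hx.1, hx.2]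

lemma integrableOn_tilt (hint : IntegrableOn h (Ioo 0 1)) (e : ℕ) :
    IntegrableOn (fun x => h x * (x - x ^ 2) ^ e) (Ioo 0 1) := by
  refine Integrable.mono' hint.norm
    (hint.1.mul (by fun_prop : Continuous fun x : ℝ => (x - x ^ 2) ^ e).aestronglyMeasurable) ?_
  refine (ae_restrict_mem measurableSet_Ioo).mono fun x hx => ?_
  rw [norm_mul, norm_pow]
  refine mul_le_of_le_one_right (norm_nonneg _) (pow_le_one₀ (norm_nonneg _) ?_)
  rw [Real.norm_eq_abs, abs_of_nonneg (sub_sq_nonneg_of_mem hx)]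
  nlinarith [hx.1, hx.2]

lemma tilt_nonneg (hnn : ∀ x ∈ Ioo (0 : ℝ) 1, 0 ≤ h x) (e : ℕ) {x : ℝ}
    (hx : x ∈ Ioo (0 : ℝ) 1) : 0 ≤ h x * (x - x ^ 2) ^ e :=
  mul_nonneg (hnn x hx) (pow_nonneg (sub_sq_nonneg_of_mem hx) e)

/-- Since `x - x² = 1/4 - (x - 1/2)²`, the window of radius `δ` alone bounds the normalizing
integral from below. -/
lemma le_integral_tilt (hnn : ∀ x ∈ Ioo (0 : ℝ) 1, 0 ≤ h x) (hint : IntegrableOn h (Ioo 0 1))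
    (e : ℕ) {δ : ℝ} (hδ0 : 0 ≤ δ) (hδ : δ ≤ 1 / 2) :
    (1 / 4 - δ ^ 2) ^ e * ∫ x in Ioo (1 / 2 - δ) (1 / 2 + δ) ∩ Ioo (0 : ℝ) 1, h x
      ≤ ∫ x in Ioo (0 : ℝ) 1, h x * (x - x ^ 2) ^ e := by
  have hsub : Ioo (1 / 2 - δ) (1 / 2 + δ) ∩ Ioo (0 : ℝ) 1 ⊆ Ioo 0 1 := inter_subset_right
  refine le_trans ?_ (setIntegral_mono_set (integrableOn_tilt hint e)
    ((ae_restrict_mem measurableSet_Ioo).mono fun x hx => tilt_nonneg hnn e hx)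
    hsub.eventuallyLE)
  rw [← integral_const_mul]
  refine setIntegral_mono_on ((hint.mono_set hsub).const_mul _)
    ((integrableOn_tilt hint e).mono_set hsub) (measurableSet_Ioo.inter measurableSet_Ioo)
    fun x hx => ?_
  rw [mul_comm]
  refine mul_le_mul_of_nonneg_left (pow_le_pow_left₀ (by nlinarith) ?_ e) (hnn x hx.2)
  nlinarith [hx.1.1, hx.1.2]

lemma integral_tilt_pos (hnn : ∀ x ∈ Ioo (0 : ℝ) 1, 0 ≤ h x) (hint : IntegrableOn h (Ioo 0 1))
    (hhalf : ∀ ε : ℝ, 0 < ε → 0 < ∫ x in Ioo (1 / 2 - ε) (1 / 2 + ε) ∩ Ioo (0 : ℝ) 1, h x)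
    (e : ℕ) : 0 < ∫ x in Ioo (0 : ℝ) 1, h x * (x - x ^ 2) ^ e :=
  (mul_pos (by norm_num) (hhalf (1 / 4) (by norm_num))).trans_le
    (le_integral_tilt hnn hint e (δ := 1 / 4) (by norm_num) (by norm_num))

end TiltedLaw

/-! ### Marginals of the random moment vector -/

section MomentLaw

variable {a b : ℝ} {n : ℕ} {f : ℕ → ℝ → ℝ}

/-- Allows `f_k` to be altered on null sets. The product formula with the indicator of `N` in place
`k` and `1` elsewhere has a vanishing factor. -/
lemma volume_canonicalMoment_mem_null (hab : a < b) {N : Set ℝ} (hN : MeasurableSet N)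
    (hN0 : volume N = 0) (k : Fin n) :
    ∀ᵐ m : Fin n → ℝ, m ∈ interiorMoments a b n → canonicalMoment a b m k ∉ N := by
  classical
  have hg : ∀ j : Fin n, Measurable (if j = k then N.indicator (1 : ℝ → ℝ≥0∞) else 1) := by
    intro j
    split_ifs
    · exact measurable_one.indicator hN
    · exact measurable_one
  have h := lintegral_prod_canonicalMoment hab n hg
  have h0 : ∫⁻ x in Ioo 0 1, N.indicator (1 : ℝ → ℝ≥0∞) x
      * ENNReal.ofReal (x - x ^ 2) ^ (n - ((k : ℕ) + 1)) = 0 := by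
    have : ∀ᵐ x, x ∉ N := measure_eq_zero_iff_ae_notMem.1 hN0
    rw [lintegral_congr_ae (g := 0) ((ae_restrict_of_ae this).mono fun x hx => by simp [hx])]
    simp
  rw [Finset.prod_eq_zero (Finset.mem_univ k) (by simp only [if_true]; rw [h0, mul_zero]),
    lintegral_eq_zero_iff (measurable_indicator_prod_canonicalMoment hab.le hg)] at h
  filter_upwards [h] with m hm hmi hmN
  rw [indicator_of_mem hmi, Pi.zero_apply, Finset.prod_eq_zero_iff] at hm
  obtain ⟨j, -, hj⟩ := hm
  by_cases hjk : j = k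
  · subst hjk
    simp [hmN] at hj
  · simp [hjk] at hj

lemma normConst_nonneg (hab : a < b)
    (hf_nonneg : ∀ k, 1 ≤ k → ∀ x ∈ Ioo (0 : ℝ) 1, 0 ≤ f k x) {k : ℕ} (hk : 1 ≤ k) :
    0 ≤ normConst a b f n k :=
  inv_nonneg.2 (mul_nonneg (pow_nonneg (sub_nonneg.2 hab.le) _)
    (setIntegral_nonneg measurableSet_Ioo fun _ hx => tilt_nonneg (hf_nonneg k hk) _ hx))

lemma ofReal_momentDensity_ae_eq (hab : a < b)
    (hf_nonneg : ∀ k, 1 ≤ k → ∀ x ∈ Ioo (0 : ℝ) 1, 0 ≤ f k x) {g : ℕ → ℝ → ℝ}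
    (hg : ∀ k, 1 ≤ k → ∀ᵐ x, x ∈ Ioo (0 : ℝ) 1 → f k x = g k x) :
    (fun m : Fin n → ℝ => ENNReal.ofReal (momentDensity a b f n m)) =ᵐ[volume]
      (interiorMoments a b n).indicator fun m =>
        ∏ k : Fin n, ENNReal.ofReal (normConst a b f n (k + 1) * g (k + 1)
          (canonicalMoment a b m k)) := by
  have hnull : ∀ k : Fin n, ∀ᵐ m : Fin n → ℝ, m ∈ interiorMoments a b n →
      f (k + 1) (canonicalMoment a b m k) = g (k + 1) (canonicalMoment a b m k) := by
    intro k
    obtain ⟨N, hsub, hN, hN0⟩ := exists_measurable_superset_of_null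
      (ae_iff.1 (hg ((k : ℕ) + 1) (Nat.le_add_left 1 _)))
    filter_upwards [volume_canonicalMoment_mem_null hab hN hN0 k] with m hm hmi
    by_contra hne
    exact hm hmi (hsub fun h => hne (h (canonicalMoment_mem_Ioo hmi k)))
  filter_upwards [ae_all_iff.2 hnull] with m hm
  by_cases hmi : m ∈ interiorMoments a b n
  · rw [indicator_of_mem hmi, momentDensity, ENNReal.ofReal_prod_of_nonneg]
    · refine Finset.prod_congr rfl fun k _ => ?_
      rw [if_pos (hmi k), hm k hmi]
    · intro k _
      rw [if_pos (hmi k)]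
      exact mul_nonneg (normConst_nonneg hab hf_nonneg (Nat.le_add_left 1 _))
        (hf_nonneg _ (Nat.le_add_left 1 _) _ (canonicalMoment_mem_Ioo hmi k))
  · rw [indicator_of_notMem hmi]
    simp only [interiorMoments, mem_ofPred_eq, not_forall] at hmi
    obtain ⟨k, hk⟩ := hmi
    rw [momentDensity, Finset.prod_eq_zero (Finset.mem_univ k) (if_neg hk), ENNReal.ofReal_zero]

/-- Inserting `φ` into the factor `k` of the product formula leaves all other factors equal to `1`,
by the choice of `normConst`. -/
lemma lintegral_momentLaw (hab : a < b)
    (hf_nonneg : ∀ k, 1 ≤ k → ∀ x ∈ Ioo (0 : ℝ) 1, 0 ≤ f k x)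
    (hf_int : ∀ k, 1 ≤ k → IntegrableOn (f k) (Ioo (0 : ℝ) 1))
    (hf_half : ∀ k, 1 ≤ k → ∀ ε : ℝ, 0 < ε →
      0 < ∫ x in Ioo (1 / 2 - ε) (1 / 2 + ε) ∩ Ioo (0 : ℝ) 1, f k x)
    (k : Fin n) {φ : ℝ → ℝ≥0∞} (hφ : Measurable φ) :
    ∫⁻ m, (interiorMoments a b n).indicator (fun m => φ (canonicalMoment a b m k)) m
        ∂(momentLaw a b f n)
      = ∫⁻ x, φ x ∂(tiltedLaw (f (k + 1)) (n - (k + 1))) := by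
  classical
  -- The product formula needs measurable functions, whereas `f k` is only almost everywhere
  -- measurable on `(0,1)`. The index `0` plays no role and gets `0`.
  have hex : ∀ k, ∃ g : ℝ → ℝ, Measurable g ∧
      (1 ≤ k → ∀ᵐ x, x ∈ Ioo (0 : ℝ) 1 → f k x = g x) := by
    intro k
    by_cases hk : 1 ≤ k
    · exact ⟨(hf_int k hk).1.mk _, (hf_int k hk).1.stronglyMeasurable_mk.measurable, fun _ =>
        (ae_restrict_iff' measurableSet_Ioo).1 (hf_int k hk).1.ae_eq_mk⟩
    · exact ⟨0, measurable_zero, fun h => absurd h hk⟩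
  choose g hgm hg using hex
  set F : Fin n → ℝ → ℝ≥0∞ := fun j x =>
    ENNReal.ofReal (normConst a b f n (j + 1) * g (j + 1) x) with hF
  have hFm : ∀ j, Measurable (F j) := fun j => ((hgm _).const_mul _).ennreal_ofReal
  have hF' : ∀ j : Fin n, ∀ᵐ x ∂(volume.restrict (Ioo (0 : ℝ) 1)),
      F j x * ENNReal.ofReal (x - x ^ 2) ^ (n - ((j : ℕ) + 1)) =
        ENNReal.ofReal (normConst a b f n (j + 1) *
          (f (j + 1) x * (x - x ^ 2) ^ (n - ((j : ℕ) + 1)))) := by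
    intro j
    filter_upwards [ae_restrict_mem measurableSet_Ioo,
      ae_restrict_of_ae (hg (j + 1) (Nat.le_add_left 1 _))] with x hx hgx
    have hx0 := sub_sq_nonneg_of_mem hx
    rw [hF, ← mul_assoc, ENNReal.ofReal_mul' (pow_nonneg hx0 _), ENNReal.ofReal_pow hx0, hgx hx]
  have hZ : ∀ j : Fin n, 0 < ∫ x in Ioo (0 : ℝ) 1,
      f (j + 1) x * (x - x ^ 2) ^ (n - ((j : ℕ) + 1)) := fun j =>
    integral_tilt_pos (hf_nonneg _ (Nat.le_add_left 1 _)) (hf_int _ (Nat.le_add_left 1 _))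
      (hf_half _ (Nat.le_add_left 1 _)) _
  have hba : 0 < b - a := sub_pos.2 hab
  set G : Fin n → ℝ → ℝ≥0∞ := fun j => if j = k then fun x => F j x * φ x else F j with hG
  have hGm : ∀ j, Measurable (G j) := by
    intro j
    simp only [hG]
    split_ifs
    · exact (hFm j).mul hφ
    · exact hFm j
  have hGprod : ∀ m, ∏ j, G j (canonicalMoment a b m j)
      = (∏ j, F j (canonicalMoment a b m j)) * φ (canonicalMoment a b m k) := by
    intro m
    have : ∀ j, G j (canonicalMoment a b m j) = F j (canonicalMoment a b m j) *
        if j = k then φ (canonicalMoment a b m k) else 1 := by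
      intro j
      simp only [hG]
      split_ifs with hj
      · rw [hj]
      · rw [mul_one]
    simp only [this, Finset.prod_mul_distrib, Finset.prod_ite_eq', Finset.mem_univ, if_true]
  have hind : Measurable ((interiorMoments a b n).indicator
      fun m => φ (canonicalMoment a b m k)) := by
    have : (interiorMoments a b n).indicator (fun m => φ (canonicalMoment a b m k))
        = (interiorMoments a b n).indicator fun m => φ
          ((interiorMoments a b n).indicator (fun m => canonicalMoment a b m k) m) :=
      indicator_congr fun m hm => by simp only [indicator_of_mem hm]
    rw [this]
    exact (hφ.comp (measurable_indicator_canonicalMoment hab.le k)).indicator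
      (measurableSet_interiorMoments hab.le n)
  rw [momentLaw, withDensity_congr_ae (ofReal_momentDensity_ae_eq hab hf_nonneg hg),
    lintegral_withDensity_eq_lintegral_mul _ (measurable_indicator_prod_canonicalMoment hab.le hFm)
      hind]
  have hmul : ((interiorMoments a b n).indicator (fun m => ∏ j, F j (canonicalMoment a b m j)) *
      (interiorMoments a b n).indicator fun m => φ (canonicalMoment a b m k))
      = (interiorMoments a b n).indicator fun m => ∏ j, G j (canonicalMoment a b m j) := by
    ext m
    by_cases hm : m ∈ interiorMoments a b n <;> simp [hm, hGprod]
  rw [hmul, lintegral_prod_canonicalMoment hab n hGm, Finset.prod_eq_single k]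
  · simp only [hG, if_true]
    rw [tiltedLaw, lintegral_withDensity_eq_lintegral_mul₀ _ hφ.aemeasurable]
    · rw [← lintegral_const_mul' _ _ ENNReal.ofReal_ne_top]
      refine lintegral_congr_ae ?_
      filter_upwards [hF' k] with x hx
      rw [mul_right_comm, hx, Pi.mul_apply, ← mul_assoc, ← ENNReal.ofReal_mul (by positivity)]
      congr 2
      have := (hZ k).ne'
      rw [normConst]
      field_simp
    · exact ((integrableOn_tilt (hf_int _ (Nat.le_add_left 1 _)) _).1.aemeasurable.const_mul
        _).ennreal_ofReal
  · intro j _ hj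
    simp only [hG, if_neg hj]
    rw [lintegral_congr_ae (hF' j), ← ofReal_integral_eq_lintegral_ofReal
      ((integrableOn_tilt (hf_int _ (Nat.le_add_left 1 _)) _).const_mul _)
      ((ae_restrict_mem measurableSet_Ioo).mono fun x hx =>
        mul_nonneg (normConst_nonneg hab hf_nonneg (Nat.le_add_left 1 _))
          (tilt_nonneg (hf_nonneg _ (Nat.le_add_left 1 _)) _ hx)),
      ← ENNReal.ofReal_mul (by positivity), integral_const_mul, normConst, ← mul_assoc,
      mul_comm ((b - a) ^ ((j : ℕ) + 1)), mul_assoc, inv_mul_cancel₀, ENNReal.ofReal_one]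
    exact (mul_pos (by positivity) (hZ j)).ne'
  · exact fun h => absurd (Finset.mem_univ k) h

/-- Under the law of the random moment vector, the canonical moment of order `k` has density
proportional to `f_k(x) (x - x²)^(n-k)`. -/
lemma hasLaw_canonicalMoment (hab : a < b)
    (hf_nonneg : ∀ k, 1 ≤ k → ∀ x ∈ Ioo (0 : ℝ) 1, 0 ≤ f k x)
    (hf_int : ∀ k, 1 ≤ k → IntegrableOn (f k) (Ioo (0 : ℝ) 1))
    (hf_half : ∀ k, 1 ≤ k → ∀ ε : ℝ, 0 < ε →
      0 < ∫ x in Ioo (1 / 2 - ε) (1 / 2 + ε) ∩ Ioo (0 : ℝ) 1, f k x) (k : Fin n) :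
    HasLaw (fun m => canonicalMoment a b m k) (tiltedLaw (f (k + 1)) (n - (k + 1)))
      (momentLaw a b f n) := by
  have hmem : ∀ᵐ m ∂(momentLaw a b f n), m ∈ interiorMoments a b n := by
    rw [ae_iff, momentLaw]
    have hm : MeasurableSet {m | m ∉ interiorMoments a b n} :=
      (measurableSet_interiorMoments hab.le n).compl
    rw [withDensity_apply _ hm]
    rw [setLIntegral_congr_fun hm (g := 0) fun m hm => ?_]
    · simp
    · simp only [interiorMoments, mem_ofPred_eq, not_forall] at hm
      obtain ⟨k, hk⟩ := hm
      simp only [Pi.zero_apply]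
      rw [momentDensity, Finset.prod_eq_zero (Finset.mem_univ k) (if_neg hk), ENNReal.ofReal_zero]
  have hae : (fun m => canonicalMoment a b m k) =ᵐ[momentLaw a b f n]
      (interiorMoments a b n).indicator fun m => canonicalMoment a b m k :=
    hmem.mono fun m hm => by simp only [indicator_of_mem hm]
  have haem : AEMeasurable (fun m => canonicalMoment a b m k) (momentLaw a b f n) :=
    ⟨_, measurable_indicator_canonicalMoment hab.le k, hae⟩
  refine ⟨haem, Measure.ext fun B hB => ?_⟩
  rw [← lintegral_indicator_one hB, lintegral_map' ((measurable_one.indicator hB).aemeasurable) haem,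
    ← lintegral_indicator_one hB,
    ← lintegral_momentLaw hab hf_nonneg hf_int hf_half k (measurable_one.indicator hB)]
  exact lintegral_congr_ae (hmem.mono fun m hm => by rw [indicator_of_mem hm])

lemma hasLaw_canonicalMomentOfOrder (hab : a < b)
    (hf_nonneg : ∀ k, 1 ≤ k → ∀ x ∈ Ioo (0 : ℝ) 1, 0 ≤ f k x)
    (hf_int : ∀ k, 1 ≤ k → IntegrableOn (f k) (Ioo (0 : ℝ) 1))
    (hf_half : ∀ k, 1 ≤ k → ∀ ε : ℝ, 0 < ε →
      0 < ∫ x in Ioo (1 / 2 - ε) (1 / 2 + ε) ∩ Ioo (0 : ℝ) 1, f k x)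
    {Ω : Type*} [MeasurableSpace Ω] {P : Measure Ω} {X : Ω → Fin n → ℝ}
    (hX : HasLaw X (momentLaw a b f n) P) {k : ℕ} (hk : 1 ≤ k) (hkn : k ≤ n) :
    HasLaw (fun ω => canonicalMomentOfOrder a b (X ω) k) (tiltedLaw (f k) (n - k)) P := by
  have h := (hasLaw_canonicalMoment hab hf_nonneg hf_int hf_half (⟨k - 1, by omega⟩ : Fin n)).comp hX
  have hk' : k - 1 + 1 = k := by omega
  simp only [hk'] at h
  convert h using 1
  ext ω
  simp [canonicalMomentOfOrder, hk, hkn]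

end MomentLaw

/-! ### Exponential concentration at `1/2` and almost sure convergence -/

section Concentration

variable {h : ℝ → ℝ}

/-- Outside radius `ε` the weight is at most `(1/4 - ε²)^e`. Using only radius `ε/2` for the
normalizer gives a strictly larger base, hence a geometric bound. -/
lemma tiltedLaw_far_le (hnn : ∀ x ∈ Ioo (0 : ℝ) 1, 0 ≤ h x) (hint : IntegrableOn h (Ioo 0 1))
    (hhalf : ∀ ε : ℝ, 0 < ε → 0 < ∫ x in Ioo (1 / 2 - ε) (1 / 2 + ε) ∩ Ioo (0 : ℝ) 1, h x)
    (e : ℕ) {ε : ℝ} (hε0 : 0 < ε) (hε : ε < 1 / 2) :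
    tiltedLaw h e {x | ε ≤ |x - 1 / 2|} ≤ ENNReal.ofReal
      ((∫ x in Ioo (0 : ℝ) 1, h x)
        / (∫ x in Ioo (1 / 2 - ε / 2) (1 / 2 + ε / 2) ∩ Ioo (0 : ℝ) 1, h x)
        * ((1 / 4 - ε ^ 2) / (1 / 4 - (ε / 2) ^ 2)) ^ e) := by
  set Z := ∫ y in Ioo (0 : ℝ) 1, h y * (y - y ^ 2) ^ e with hZ
  set I := ∫ x in Ioo (1 / 2 - ε / 2) (1 / 2 + ε / 2) ∩ Ioo (0 : ℝ) 1, h x with hI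
  have hIpos : 0 < I := hhalf _ (half_pos hε0)
  have hZpos : 0 < Z := integral_tilt_pos hnn hint hhalf e
  have hq : 0 ≤ 1 / 4 - ε ^ 2 := by nlinarith
  have hr : 0 < 1 / 4 - (ε / 2) ^ 2 := by nlinarith
  have hJ : 0 ≤ ∫ x in Ioo (0 : ℝ) 1, h x := setIntegral_nonneg measurableSet_Ioo hnn
  have hle : (1 / 4 - (ε / 2) ^ 2) ^ e * I ≤ Z :=
    le_integral_tilt hnn hint e (by positivity) (by linarith)
  have hS : MeasurableSet {x : ℝ | ε ≤ |x - 1 / 2|} :=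
    measurableSet_le measurable_const (by fun_prop)
  have hbound : ∀ x ∈ {x : ℝ | ε ≤ |x - 1 / 2|} ∩ Ioo 0 1,
      ENNReal.ofReal (Z⁻¹ * (h x * (x - x ^ 2) ^ e))
        ≤ ENNReal.ofReal (Z⁻¹ * (1 / 4 - ε ^ 2) ^ e * h x) := by
    intro x hx
    refine ENNReal.ofReal_le_ofReal ?_
    have h1 : x - x ^ 2 ≤ 1 / 4 - ε ^ 2 := by
      have : ε ^ 2 ≤ (x - 1 / 2) ^ 2 := by
        rw [← sq_abs (x - 1 / 2)]
        exact pow_le_pow_left₀ hε0.le hx.1 2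
      nlinarith
    rw [mul_assoc, mul_comm (h x)]
    have := mul_le_mul_of_nonneg_right
      (pow_le_pow_left₀ (sub_sq_nonneg_of_mem hx.2) h1 e) (hnn x hx.2)
    exact mul_le_mul_of_nonneg_left this (inv_nonneg.2 hZpos.le)
  rw [tiltedLaw, withDensity_apply _ hS, Measure.restrict_restrict hS]
  refine (setLIntegral_mono' (hS.inter measurableSet_Ioo) hbound).trans ?_
  refine (lintegral_mono_set inter_subset_right).trans ?_
  rw [← ofReal_integral_eq_lintegral_ofReal (hint.const_mul _)
    ((ae_restrict_mem measurableSet_Ioo).mono fun x hx =>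
      mul_nonneg (by positivity) (hnn x hx)), integral_const_mul]
  refine ENNReal.ofReal_le_ofReal ?_
  calc Z⁻¹ * (1 / 4 - ε ^ 2) ^ e * ∫ x in Ioo (0 : ℝ) 1, h x
      ≤ ((1 / 4 - (ε / 2) ^ 2) ^ e * I)⁻¹ * (1 / 4 - ε ^ 2) ^ e * ∫ x in Ioo (0 : ℝ) 1, h x := by
        gcongr
    _ = _ := by
        generalize 1 / 4 - ε ^ 2 = u
        generalize 1 / 4 - (ε / 2) ^ 2 = v
        rw [div_pow, mul_inv]
        ring

/-- The deviation probabilities are summable, and the first Borel–Cantelli lemma needs no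
independence. -/
lemma ae_tendsto_half_of_hasLaw (hnn : ∀ x ∈ Ioo (0 : ℝ) 1, 0 ≤ h x)
    (hint : IntegrableOn h (Ioo 0 1))
    (hhalf : ∀ ε : ℝ, 0 < ε → 0 < ∫ x in Ioo (1 / 2 - ε) (1 / 2 + ε) ∩ Ioo (0 : ℝ) 1, h x)
    {Ω : Type*} [MeasurableSpace Ω] {P : Measure Ω} {Y : ℕ → Ω → ℝ}
    (hY : ∀ n, HasLaw (Y n) (tiltedLaw h n) P) :
    ∀ᵐ ω ∂P, Tendsto (fun n => Y n ω) atTop (𝓝 (1 / 2)) := by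
  -- Countably many thresholds suffice; the shift by `3` keeps them below `1/2`.
  have hev : ∀ j : ℕ, ∀ᵐ ω ∂P, ∀ᶠ n in atTop, ω ∉ {ω | 1 / ((j : ℝ) + 3) ≤ |Y n ω - 1 / 2|} := by
    intro j
    set ε : ℝ := 1 / ((j : ℝ) + 3) with hε
    have hj : (0 : ℝ) ≤ j := Nat.cast_nonneg j
    have hε0 : 0 < ε := by positivity
    have hε1 : ε < 1 / 2 := by
      rw [hε, div_lt_div_iff₀ (by positivity) (by norm_num)]
      linarith
    have hr : 0 < 1 / 4 - (ε / 2) ^ 2 := by nlinarith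
    refine ae_eventually_notMem ?_
    have hS : MeasurableSet {x : ℝ | ε ≤ |x - 1 / 2|} :=
      measurableSet_le measurable_const (by fun_prop)
    refine ne_top_of_le_ne_top (Summable.tsum_ofReal_ne_top ?_) (ENNReal.tsum_le_tsum fun n => by
      rw [(hY n).measure_eq (p := fun y => ε ≤ |y - 1 / 2|) hS]
      exact tiltedLaw_far_le hnn hint hhalf n hε0 hε1)
    refine (summable_geometric_of_lt_one (div_nonneg (by nlinarith) hr.le) ?_).mul_left _
    rw [div_lt_one hr]
    nlinarith
  filter_upwards [ae_all_iff.2 hev] with ω hω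
  rw [Metric.tendsto_atTop']
  intro δ hδ
  obtain ⟨j, hj⟩ := exists_nat_one_div_lt hδ
  obtain ⟨N, hN⟩ := eventually_atTop.1 (hω j)
  refine ⟨N, fun n hn => ?_⟩
  have h1 := hN n hn.le
  simp only [not_le] at h1
  rw [Real.dist_eq]
  refine h1.trans (lt_of_le_of_lt ?_ hj)
  gcongr
  norm_num

end Concentration

/-! ### Laplace's method and asymptotic normality -/

section CentralLimit

open BoundedContinuousFunction

variable {h : ℝ → ℝ}

lemma integrableOn_test_mul_tilt (hint : IntegrableOn h (Ioo 0 1)) (e : ℕ) (φ : ℝ →ᵇ ℝ) (c : ℝ) :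
    IntegrableOn (fun x => φ (c * (x - 1 / 2)) * (h x * (4 * (x - x ^ 2)) ^ e)) (Ioo 0 1) := by
  refine Integrable.bdd_mul (c := ‖φ‖) ?_ ?_ (ae_of_all _ fun x => φ.norm_coe_le_norm _)
  · refine ((integrableOn_tilt hint e).const_mul (4 ^ e)).congr (ae_of_all _ fun x => ?_)
    simp only [mul_pow]
    ring
  · exact (φ.continuous.comp (by fun_prop)).aestronglyMeasurable

lemma scaled_setIntegral_eq {B : Set ℝ} (hB : MeasurableSet B) (g : ℝ → ℝ) {c : ℝ} (hc : 0 < c) :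
    c * ∫ x in B, g x = ∫ y, B.indicator g (1 / 2 + y / c) := by
  rw [Measure.integral_comp_div (fun t => B.indicator g (1 / 2 + t)) c,
    integral_add_left_eq_self (B.indicator g), integral_indicator hB, abs_of_pos hc, smul_eq_mul]

lemma tendsto_one_sub_div_pow (y : ℝ) (k : ℕ) :
    Tendsto (fun n : ℕ => (1 - y ^ 2 / (2 * n)) ^ (n - k)) atTop (𝓝 (Real.exp (-y ^ 2 / 2))) := by
  have h1 := Real.tendsto_one_add_div_pow_exp (-y ^ 2 / 2)
  have h2 : Tendsto (fun n : ℕ => 1 + (-y ^ 2 / 2) / (n : ℝ)) atTop (𝓝 1) := by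
    have := (tendsto_const_div_atTop_nhds_zero_nat (-y ^ 2 / 2)).const_add 1
    rwa [add_zero] at this
  have h3 := h1.div (h2.pow k) (by simp)
  rw [one_pow, div_one] at h3
  refine h3.congr' ?_
  filter_upwards [eventually_ge_atTop k, h2.eventually_ne one_ne_zero, eventually_gt_atTop 0]
    with n hn hne hn0
  have e1 : 1 - y ^ 2 / (2 * (n : ℝ)) = 1 + (-y ^ 2 / 2) / (n : ℝ) := by
    have : (n : ℝ) ≠ 0 := by positivity
    field_simp
    ring
  rw [e1, Pi.div_apply, pow_sub₀ _ hne hn, div_eq_mul_inv]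

lemma tendsto_sqrt_mul_pow_sub {q : ℝ} (hq0 : 0 < q) (hq : q < 1) (k : ℕ) :
    Tendsto (fun n : ℕ => Real.sqrt (8 * n) * q ^ (n - k)) atTop (𝓝 0) := by
  have h1 := (tendsto_self_mul_const_pow_of_lt_one hq0.le hq).const_mul (8 / q ^ k)
  rw [mul_zero] at h1
  refine squeeze_zero' (Eventually.of_forall fun n => by positivity) ?_ h1
  filter_upwards [eventually_ge_atTop k, eventually_ge_atTop 1] with n hn hn1
  have hn1' : (1 : ℝ) ≤ n := by exact_mod_cast hn1
  have hs : Real.sqrt (8 * n) ≤ 8 * n := by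
    rw [Real.sqrt_le_left (by positivity)]
    nlinarith
  rw [pow_sub₀ _ hq0.ne' hn]
  calc Real.sqrt (8 * n) * (q ^ n * (q ^ k)⁻¹) ≤ (8 * n) * (q ^ n * (q ^ k)⁻¹) := by gcongr
    _ = _ := by ring

/-- Laplace's method for the weights `h(x) (4 (x - x²))^(n-k)` near `1/2`. -/
lemma tendsto_sqrt_mul_integral (hint : IntegrableOn h (Ioo 0 1)) (hc : ContinuousAt h (1 / 2))
    (k : ℕ) (φ : ℝ →ᵇ ℝ) :
    Tendsto (fun n : ℕ => Real.sqrt (8 * n) * ∫ x in Ioo (0 : ℝ) 1,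
        φ (Real.sqrt (8 * n) * (x - 1 / 2)) * (h x * (4 * (x - x ^ 2)) ^ (n - k))) atTop
      (𝓝 (∫ y, φ y * (h (1 / 2) * Real.exp (-y ^ 2 / 2)))) := by
  obtain ⟨δ', hδ'0, hδ'⟩ := Metric.continuousAt_iff.1 hc 1 one_pos
  -- The radius `δ'` keeps `h` bounded on the window; the cap `1/4` keeps the window inside `(0,1)`.
  set δ := min δ' (1 / 4) with hδ
  have hδ0 : 0 < δ := lt_min hδ'0 (by norm_num)
  have hδ4 : δ ≤ 1 / 4 := min_le_right _ _
  set M := |h (1 / 2)| + 1 with hM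
  have hM0 : 0 ≤ M := by positivity
  set B : Set ℝ := Ioo (1 / 2 - δ) (1 / 2 + δ) with hBdef
  have hB : MeasurableSet B := measurableSet_Ioo
  have hBsub : B ⊆ Ioo 0 1 := fun x hx => ⟨by linarith [hx.1], by linarith [hx.2]⟩
  have hMB : ∀ x ∈ B, |h x| ≤ M := by
    intro x hx
    have hd : dist x (1 / 2) < δ' := by
      rw [Real.dist_eq, abs_lt]
      have := min_le_left δ' (1 / 4)
      constructor <;> linarith [hx.1, hx.2]
    have h1 := hδ' hd
    rw [Real.dist_eq] at h1
    have h2 := abs_sub_abs_le_abs_sub (h x) (h (1 / 2))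
    rw [hM]
    linarith
  let g : ℕ → ℝ → ℝ := fun n x =>
    φ (Real.sqrt (8 * n) * (x - 1 / 2)) * (h x * (4 * (x - x ^ 2)) ^ (n - k))
  have hg : ∀ n, IntegrableOn (g n) (Ioo 0 1) := fun n =>
    integrableOn_test_mul_tilt hint _ φ _
  have hsq : ∀ {n : ℕ}, 0 < n → 0 < Real.sqrt (8 * n) := fun {n} hn => by positivity
  -- The scale `√(8n)` turns `4 (x - 1/2)²` into `y²/(2n)`, giving variance `1` in the limit.
  have hval : ∀ {n : ℕ}, 0 < n → ∀ y : ℝ, g n (1 / 2 + y / Real.sqrt (8 * n)) =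
      φ y * (h (1 / 2 + y / Real.sqrt (8 * n)) * (1 - y ^ 2 / (2 * n)) ^ (n - k)) := by
    intro n hn y
    have hs := (hsq hn).ne'
    have hs2 : Real.sqrt (8 * n) ^ 2 = 8 * n := Real.sq_sqrt (by positivity)
    have hn' : (n : ℝ) ≠ 0 := by positivity
    have e1 : Real.sqrt (8 * n) * (1 / 2 + y / Real.sqrt (8 * n) - 1 / 2) = y := by
      field_simp
      ring
    have e2 : 4 * (1 / 2 + y / Real.sqrt (8 * n) - (1 / 2 + y / Real.sqrt (8 * n)) ^ 2)
        = 1 - y ^ 2 / (2 * n) := by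
      have : (y / Real.sqrt (8 * n)) ^ 2 = y ^ 2 / (8 * n) := by rw [div_pow, hs2]
      have e3 : y ^ 2 / (2 * n) = 4 * (y ^ 2 / (8 * n)) := by field_simp; ring
      rw [e3, ← this]
      ring
    simp only [g, e1, e2]
  have hnear : Tendsto (fun n : ℕ => Real.sqrt (8 * n) * ∫ x in B, g n x) atTop
      (𝓝 (∫ y, φ y * (h (1 / 2) * Real.exp (-y ^ 2 / 2)))) := by
    have hlim : Tendsto (fun n : ℕ => ∫ y, B.indicator (g n) (1 / 2 + y / Real.sqrt (8 * n))) atTop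
        (𝓝 (∫ y, φ y * (h (1 / 2) * Real.exp (-y ^ 2 / 2)))) := by
      -- For `n ≥ 2k` one has `n - k ≥ n/2`, so on the window `(1 - y²/(2n))^(n-k) ≤ exp(-y²/4)`.
      refine tendsto_integral_filter_of_dominated_convergence
        (fun y => ‖φ‖ * (M * Real.exp (-(1 / 4) * y ^ 2))) ?_ ?_ ?_ ?_
      · filter_upwards [eventually_gt_atTop 0] with n hn
        have hi : Integrable (B.indicator (g n)) :=
          ((hg n).mono_set hBsub).integrable_indicator hB
        exact ((hi.comp_add_left (1 / 2)).comp_div (hsq hn).ne').1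
      · filter_upwards [eventually_gt_atTop 0, eventually_ge_atTop (2 * k)] with n hn hnk
        refine ae_of_all _ fun y => ?_
        by_cases hy : 1 / 2 + y / Real.sqrt (8 * n) ∈ B
        · rw [indicator_of_mem hy, hval hn, norm_mul, norm_mul]
          refine mul_le_mul (φ.norm_coe_le_norm _) (mul_le_mul (hMB _ hy) ?_ (norm_nonneg _) hM0)
            (by positivity) (norm_nonneg _)
          have hn' : (0 : ℝ) < n := by exact_mod_cast hn
          have hs2 : Real.sqrt (8 * n) ^ 2 = 8 * n := Real.sq_sqrt (by positivity)
          have hy2 : y ^ 2 / (2 * n) ≤ 1 := by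
            have h1 : |y / Real.sqrt (8 * n)| ≤ 1 / 4 := by
              rw [abs_le]
              constructor <;> linarith [hy.1, hy.2]
            have h2 : (y / Real.sqrt (8 * n)) ^ 2 ≤ (1 / 4) ^ 2 := by
              rw [← sq_abs]
              exact pow_le_pow_left₀ (abs_nonneg _) h1 2
            rw [div_pow, hs2, div_le_iff₀ (by positivity)] at h2
            rw [div_le_one (by positivity)]
            linarith
          rw [norm_pow, Real.norm_eq_abs, abs_of_nonneg (by linarith)]
          refine (pow_le_pow_left₀ (by linarith) (Real.one_sub_le_exp_neg _) _).trans ?_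
          rw [← Real.exp_nat_mul, Real.exp_le_exp]
          have hk2 : (n : ℝ) / 2 ≤ ((n - k : ℕ) : ℝ) := by
            rw [Nat.cast_sub (by omega)]
            have : (2 : ℝ) * k ≤ n := by exact_mod_cast hnk
            linarith
          have h3 : (n : ℝ) / 2 * (y ^ 2 / (2 * n)) ≤ ((n - k : ℕ) : ℝ) * (y ^ 2 / (2 * n)) :=
            mul_le_mul_of_nonneg_right hk2 (by positivity)
          have h4 : (n : ℝ) / 2 * (y ^ 2 / (2 * n)) = 1 / 4 * y ^ 2 := by
            field_simp
            ring
          linarith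
        · rw [indicator_of_notMem hy, norm_zero]
          positivity
      · exact ((integrable_exp_neg_mul_sq (by norm_num)).const_mul _).const_mul _
      · refine ae_of_all _ fun y => ?_
        have hx : Tendsto (fun n : ℕ => 1 / 2 + y / Real.sqrt (8 * n)) atTop (𝓝 (1 / 2)) := by
          have hs : Tendsto (fun n : ℕ => Real.sqrt (8 * n)) atTop atTop :=
            Real.tendsto_sqrt_atTop.comp
              (tendsto_natCast_atTop_atTop.const_mul_atTop (by norm_num))
          have := (hs.const_div_atTop y).const_add (1 / 2)
          rwa [add_zero] at this
        have hBev : ∀ᶠ n : ℕ in atTop, 1 / 2 + y / Real.sqrt (8 * n) ∈ B :=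
          hx.eventually (Ioo_mem_nhds (by linarith) (by linarith))
        refine (((hc.tendsto.comp hx).mul (tendsto_one_sub_div_pow y k)).const_mul (φ y)).congr' ?_
        filter_upwards [hBev, eventually_gt_atTop 0] with n hn hn0
        rw [indicator_of_mem hn, hval hn0]
        rfl
    refine hlim.congr' ?_
    filter_upwards [eventually_gt_atTop 0] with n hn
    rw [scaled_setIntegral_eq hB _ (hsq hn)]
  -- Off the window `4 (x - x²) ≤ q < 1`, and geometric decay beats `√(8n)`.
  have hfar : Tendsto (fun n : ℕ => Real.sqrt (8 * n) * ∫ x in Ioo 0 1 \ B, g n x) atTop (𝓝 0) := by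
    set q := 1 - 4 * δ ^ 2 with hq
    have hq0 : 0 < q := by nlinarith
    have hq1 : q < 1 := by nlinarith
    have h1 := (tendsto_sqrt_mul_pow_sub hq0 hq1 k).mul_const (‖φ‖ * ∫ x in Ioo (0 : ℝ) 1, |h x|)
    rw [zero_mul] at h1
    refine squeeze_zero_norm (fun n => ?_) h1
    rw [norm_mul, Real.norm_of_nonneg (Real.sqrt_nonneg _), mul_assoc]
    refine mul_le_mul_of_nonneg_left ?_ (Real.sqrt_nonneg _)
    have hb : ∀ᵐ x ∂(volume.restrict (Ioo (0 : ℝ) 1 \ B)),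
        ‖g n x‖ ≤ q ^ (n - k) * ‖φ‖ * |h x| := by
      filter_upwards [ae_restrict_mem (measurableSet_Ioo.diff hB)] with x hx
      have hx0 := sub_sq_nonneg_of_mem hx.1
      have hxq : 4 * (x - x ^ 2) ≤ q := by
        have : δ ≤ |x - 1 / 2| := by
          by_contra hlt
          rw [not_le, abs_lt] at hlt
          exact hx.2 ⟨by linarith [hlt.1], by linarith [hlt.2]⟩
        have h2 : δ ^ 2 ≤ (x - 1 / 2) ^ 2 := by
          rw [← sq_abs (x - 1 / 2)]
          exact pow_le_pow_left₀ hδ0.le this 2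
        rw [hq]
        nlinarith
      simp only [g]
      rw [norm_mul, norm_mul, norm_pow, Real.norm_of_nonneg (by linarith : 0 ≤ 4 * (x - x ^ 2))]
      calc ‖φ (Real.sqrt (8 * n) * (x - 1 / 2))‖ * (‖h x‖ * (4 * (x - x ^ 2)) ^ (n - k))
          ≤ ‖φ‖ * (‖h x‖ * q ^ (n - k)) := by
            gcongr
            exact φ.norm_coe_le_norm _
        _ = _ := by rw [Real.norm_eq_abs]; ring
    have habs : IntegrableOn (fun x => |h x|) (Ioo 0 1) := hint.norm
    refine (norm_integral_le_of_norm_le ((habs.mono_set sdiff_subset).const_mul _) hb).trans ?_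
    rw [integral_const_mul, mul_assoc]
    refine mul_le_mul_of_nonneg_left (mul_le_mul_of_nonneg_left ?_ (norm_nonneg _))
      (pow_nonneg hq0.le _)
    exact setIntegral_mono_set habs (ae_of_all _ fun x => abs_nonneg _) sdiff_subset.eventuallyLE
  have hsum := hnear.add hfar
  rw [add_zero] at hsum
  refine hsum.congr fun n => ?_
  rw [← mul_add]
  congr 1
  have := integral_inter_add_sdiff hB (hg n)
  rwa [inter_eq_self_of_subset_right hBsub] at this

/-- The factors `c` and `4 ^ e` cancel; with `c = √(8n)` they give numerator and denominator
separate finite limits. -/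
lemma integral_tiltedLaw (hnn : ∀ x ∈ Ioo (0 : ℝ) 1, 0 ≤ h x) (hint : IntegrableOn h (Ioo 0 1))
    (e : ℕ) {c : ℝ} (hc : 0 < c) (φ : ℝ → ℝ) :
    ∫ x, φ x ∂(tiltedLaw h e)
      = (c * ∫ x in Ioo (0 : ℝ) 1, φ x * (h x * (4 * (x - x ^ 2)) ^ e))
        / (c * ∫ x in Ioo (0 : ℝ) 1, h x * (4 * (x - x ^ 2)) ^ e) := by
  have hZ : 0 ≤ ∫ y in Ioo (0 : ℝ) 1, h y * (y - y ^ 2) ^ e :=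
    setIntegral_nonneg measurableSet_Ioo fun _ hx => tilt_nonneg hnn e hx
  rw [tiltedLaw, integral_withDensity_eq_integral_toReal_smul₀
    ((integrableOn_tilt hint e).1.aemeasurable.const_mul _).ennreal_ofReal
    (ae_of_all _ fun _ => ENNReal.ofReal_lt_top),
    setIntegral_congr_fun measurableSet_Ioo (g := fun x =>
      (∫ y in Ioo (0 : ℝ) 1, h y * (y - y ^ 2) ^ e)⁻¹ * (φ x * (h x * (x - x ^ 2) ^ e)))
    fun x hx => ?_, integral_const_mul]
  · have e1 : ∀ x : ℝ, φ x * (4 ^ e * (h x * (x - x ^ 2) ^ e))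
        = 4 ^ e * (φ x * (h x * (x - x ^ 2) ^ e)) := fun x => by ring
    have e2 : ∀ x : ℝ, h x * (4 * (x - x ^ 2)) ^ e = 4 ^ e * (h x * (x - x ^ 2) ^ e) := fun x => by
      rw [mul_pow]; ring
    simp only [e2, e1, integral_const_mul]
    rw [mul_div_mul_left _ _ hc.ne', mul_div_mul_left _ _ (by positivity), div_eq_inv_mul]
  · simp only [smul_eq_mul]
    rw [ENNReal.toReal_ofReal (mul_nonneg (inv_nonneg.2 hZ) (tilt_nonneg hnn e hx))]
    ring

lemma integral_gaussianReal_std (φ : ℝ → ℝ) {c : ℝ} (hc : c ≠ 0) :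
    ∫ y, φ y ∂(gaussianReal 0 1) = (∫ y, φ y * (c * Real.exp (-y ^ 2 / 2)))
      / ∫ y, c * Real.exp (-y ^ 2 / 2) := by
  have h1 : ∫ y : ℝ, Real.exp (-y ^ 2 / 2) = Real.sqrt (2 * Real.pi) := by
    have := integral_gaussian (1 / 2)
    rw [show Real.pi / (1 / 2) = 2 * Real.pi by ring] at this
    rw [← this]
    congr 1
    ext y
    congr 1
    ring
  have h2 : ∀ y, φ y * (c * Real.exp (-y ^ 2 / 2)) = c * (φ y * Real.exp (-y ^ 2 / 2)) :=
    fun y => by ring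
  rw [integral_gaussianReal_eq_integral_smul one_ne_zero, integral_const_mul, h1]
  simp only [h2, integral_const_mul]
  rw [mul_div_mul_left _ _ hc, div_eq_inv_mul, ← integral_const_mul]
  congr 1
  ext y
  simp [gaussianPDFReal_def]
  ring

/-- Asymptotic normality of the laws with densities proportional to `h(x) (x - x²)^(n-k)`. -/
lemma tendsto_integral_tiltedLaw (hnn : ∀ x ∈ Ioo (0 : ℝ) 1, 0 ≤ h x)
    (hint : IntegrableOn h (Ioo 0 1)) (hc : ContinuousAt h (1 / 2)) (hpos : 0 < h (1 / 2))
    (k : ℕ) (φ : ℝ →ᵇ ℝ) :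
    Tendsto (fun n : ℕ => ∫ x, φ (Real.sqrt (8 * n) * (x - 1 / 2)) ∂(tiltedLaw h (n - k))) atTop
      (𝓝 (∫ y, φ y ∂(gaussianReal 0 1))) := by
  have h1 := tendsto_sqrt_mul_integral hint hc k φ
  -- The constant test function yields the limit of the normalizing denominator.
  have h2 := tendsto_sqrt_mul_integral hint hc k (BoundedContinuousFunction.const ℝ 1)
  simp only [BoundedContinuousFunction.const_apply, one_mul] at h2
  have hne : ∫ y : ℝ, h (1 / 2) * Real.exp (-y ^ 2 / 2) ≠ 0 := by
    have := integral_gaussian (1 / 2)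
    rw [integral_const_mul]
    refine mul_ne_zero hpos.ne' ?_
    have e : ∫ y : ℝ, Real.exp (-y ^ 2 / 2) = Real.sqrt (Real.pi / (1 / 2)) := by
      rw [← this]
      congr 1
      ext y
      congr 1
      ring
    rw [e]
    positivity
  rw [integral_gaussianReal_std φ hpos.ne']
  refine (h1.div h2 hne).congr' ?_
  filter_upwards [eventually_gt_atTop 0] with n hn
  have hs : 0 < Real.sqrt (8 * n) := by positivity
  rw [integral_tiltedLaw hnn hint _ hs fun x => φ (Real.sqrt (8 * n) * (x - 1 / 2))]
  rfl

end CentralLimit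

end RandomMoments

end

/-! ### The limit theorems for the canonical moments -/

theorem mainTheorem8 (a b : ℝ) (hab : a < b) (f : ℕ → ℝ → ℝ)
    (hf_nonneg : ∀ k, 1 ≤ k → ∀ x ∈ Ioo (0 : ℝ) 1, 0 ≤ f k x)
    (hf_int : ∀ k, 1 ≤ k → IntegrableOn (f k) (Ioo (0 : ℝ) 1))
    (hf_half : ∀ k, 1 ≤ k → ∀ ε : ℝ, 0 < ε →
      0 < ∫ x in Ioo (1 / 2 - ε) (1 / 2 + ε) ∩ Ioo (0 : ℝ) 1, f k x)
    {Ω : Type*} [MeasurableSpace Ω] (P : Measure Ω) [IsProbabilityMeasure P]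
    (X : (n : ℕ) → Ω → (Fin n → ℝ))
    (hX_mem : ∀ n, 1 ≤ n → ∀ᵐ ω ∂P, X n ω ∈ RandomMoments.momentSpace a b n)
    (hX_law : ∀ n, 1 ≤ n → HasLaw (X n) (RandomMoments.momentLaw a b f n) P) :
    (∀ᵐ ω ∂P, ∀ k : ℕ, 1 ≤ k →
      Tendsto (fun n : ℕ => RandomMoments.canonicalMomentOfOrder a b (X n ω) k) atTop
        (𝓝 (1 / 2))) ∧
    (∀ k : ℕ, 1 ≤ k → ContinuousAt (f k) (1 / 2) → 0 < f k (1 / 2) →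
      TendstoInDistribution
        (fun (n : ℕ) (ω : Ω) =>
          Real.sqrt (8 * n) * (RandomMoments.canonicalMomentOfOrder a b (X n ω) k - 1 / 2))
        atTop (id : ℝ → ℝ) (fun _ => P) (gaussianReal 0 1)) := by
  have hlaw : ∀ k, 1 ≤ k → ∀ n, k ≤ n →
      HasLaw (fun ω => RandomMoments.canonicalMomentOfOrder a b (X n ω) k)
        (RandomMoments.tiltedLaw (f k) (n - k)) P := fun k hk n hkn =>
    RandomMoments.hasLaw_canonicalMomentOfOrder hab hf_nonneg hf_int hf_half
      (hX_law n (hk.trans hkn)) hk hkn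
  refine ⟨?_, fun k hk hcont hpos => ?_⟩
  · refine ae_all_iff.2 fun k => ?_
    by_cases hk : 1 ≤ k
    · have h := RandomMoments.ae_tendsto_half_of_hasLaw (hf_nonneg k hk) (hf_int k hk)
        (hf_half k hk) (P := P)
        -- Shifting the index by `k` ensures that the canonical moment exists and makes the exponent
        -- exactly `n`.
        (Y := fun n ω => RandomMoments.canonicalMomentOfOrder a b (X (n + k) ω) k) fun n => by
          simpa using hlaw k hk (n + k) (Nat.le_add_left k n)
      filter_upwards [h] with ω hω _
      exact (tendsto_add_atTop_iff_nat
        (f := fun n => RandomMoments.canonicalMomentOfOrder a b (X n ω) k) k).1 hω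
    · exact ae_of_all _ fun ω h => absurd h hk
  · have haem : ∀ n : ℕ, AEMeasurable (fun ω => Real.sqrt (8 * n) *
        (RandomMoments.canonicalMomentOfOrder a b (X n ω) k - 1 / 2)) P := by
      intro n
      by_cases hkn : k ≤ n
      · exact ((hlaw k hk n hkn).aemeasurable.sub_const _).const_mul _
      -- For `n < k` the canonical moment takes its default value `0`, so measurability is trivial.
      · have h0 : ∀ ω, RandomMoments.canonicalMomentOfOrder a b (X n ω) k = 0 := fun ω =>
          dif_neg fun h => hkn h.2
        simp only [h0]
        exact aemeasurable_const
    refine ⟨haem, aemeasurable_id,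
      ProbabilityMeasure.tendsto_iff_forall_integral_tendsto.2 fun φ => ?_⟩
    change Tendsto (fun n : ℕ => ∫ x, φ x ∂(P.map fun ω => Real.sqrt (8 * n) *
      (RandomMoments.canonicalMomentOfOrder a b (X n ω) k - 1 / 2))) atTop
      (𝓝 (∫ x, φ x ∂((gaussianReal 0 1).map id)))
    rw [Measure.map_id]
    refine (RandomMoments.tendsto_integral_tiltedLaw (hf_nonneg k hk) (hf_int k hk) hcont hpos k
      φ).congr' ?_
    filter_upwards [eventually_ge_atTop k] with n hkn
    have hl := hlaw k hk n hkn
    have hφ : Continuous fun x : ℝ => φ (Real.sqrt (8 * n) * (x - 1 / 2)) :=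
      φ.continuous.comp (by fun_prop)
    rw [integral_map (haem n) φ.continuous.aestronglyMeasurable, ← hl.map_eq,
      integral_map hl.aemeasurable hφ.aestronglyMeasurable]
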